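/- Notation. A partition $\lambda=(\lambda_1\ge\lambda_2\ge\cdots\ge 0)$ is identified with its Young diagram, $\ell(\lambda)$ is the number of its nonzero parts, $\lambda'$ is the conjugate partition, and $\mu\subset\lambda$ means containment of diagrams. Let $x=(x_1,x_2,\ldots)$ and $y=(y_1,y_2,\ldots)$ be two sequences of independent commuting variables. In a given set of variables, $h_r$ and $e_r$ ($r\in\mathbb Z$) denote the complete and the elementary symmetric functions (the sum of all monomials, respectively of all squarefree monomials, of degree $r$), with $h_0=e_0=1$ and $h_r=e_r=0$ for $r<0$, and $h_\alpha=\prod_i h_{\alpha_i}$ for an integer vector $\alpha$. For $\mu\subset\lambda$, a tableau $T$ on $\lambda/\mu$ is a filling of the boxes of $\lambda/\mu$ with positive integers that is weakly increasing along rows and strictly increasing down columns; its content $c(T)$ is the vector whose $k$-th entry is the number of boxes containing $k$. The skew Schur function is $s_{\lambda/\mu}(x)=\sum_T x^{c(T)}$, summed over all tableaux $T$ on $\lambda/\mu$, and for a composition $\alpha\ge 0$ (a finitely supported sequence of nonnegative integers) the Kostka number $K_{\mu,\alpha}$ is the number of tableaux of shape $\mu=\mu/\emptyset$ and content $\alpha$.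 For an integer vector $\alpha$ of length $\ell$ (that is, $\alpha_\ell\ne 0$ and $\alpha_i=0$ for $i>\ell$; $\ell=0$ if $\alpha=0$), the Schur function $s_\alpha$ is $\prod_{1\le i<j\le\ell}(1-R_{ij})\,h_\alpha$, where the raising operator $R_{ij}$ acts on the index by $\alpha\mapsto(\ldots,\alpha_i+1,\ldots,\alpha_j-1,\ldots)$; $s_\alpha(x)$, $s_\alpha(y)$ and $s_\alpha(x,y)$ are obtained by taking the $h_r$ in the variables $x$, $y$, and $x$ and $y$ together. Theorem. Let $\lambda$ be a partition, $\ell=\ell(\lambda)$, $\rho_\ell=(\ell-1,\ldots,1,0)$. (1) For every partition $\mu\subset\lambda$, $$s_{\lambda/\mu}=\sum_{w\in S_\ell}(-1)^w\,h_{\lambda+\rho_\ell-w(\mu+\rho_\ell)}=\det\bigl(h_{\lambda_i-\mu_j+j-i}\bigr)_{1\le i,j\le\ell}.$$ (2) For every partition $\mu\subset\lambda$, $$s_{\lambda'/\mu'}=\det\bigl(e_{\lambda_i-\mu_j+j-i}\bigr)_{1\le i,j\le\ell}.$$ (3) $$s_\lambda(x,y)=\sum_{\mu\subset\lambda}s_{\lambda/\mu}(x)\,s_\mu(y),$$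 summed over the partitions $\mu\subset\lambda$. (4) For every partition $\mu\subset\lambda$, $$s_{\lambda/\mu}=\sum_{\alpha\ge 0}K_{\mu,\alpha}\,s_{\lambda-\alpha},$$ summed over all compositions $\alpha\ge0$; only finitely many terms are nonzero. -/

import Mathlib

noncomputable section

namespace SkewJT

/-! ### Integer vectors -/

/-- The length of an integer vector `(α₁, α₂, …)` with finitely many nonzero entries: the largest
`ℓ` with `α_ℓ ≠ 0` (and `0` for the zero vector). Entries are indexed from `0` here, so `α i` is
the entry `α_{i+1}`. -/
def vecLength (α : ℕ →₀ ℤ) : ℕ := α.support.sup fun i => i + 1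

/-- A composition (a finitely supported vector of natural numbers) as an integer vector. -/
def compVec (α : ℕ →₀ ℕ) : ℕ →₀ ℤ := α.mapRange (fun k : ℕ => (k : ℤ)) rfl

/-- A partition, given by its Young diagram, as the integer vector of its row lengths. -/
def partVec (lam : YoungDiagram) : ℕ →₀ ℤ :=
  Finsupp.onFinset (Finset.range (lam.colLen 0)) (fun i => (lam.rowLen i : ℤ)) (by
    intro i hi
    rw [Finset.mem_range, ← YoungDiagram.mem_iff_lt_colLen, YoungDiagram.mem_iff_lt_rowLen]
    exact Nat.pos_of_ne_zero fun h => hi (by simp [h]))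

/-- The number of nonzero parts of a partition. -/
def partLength (lam : YoungDiagram) : ℕ := lam.colLen 0

theorem finite_le (lam : YoungDiagram) : {mu : YoungDiagram | mu ≤ lam}.Finite := by
  refine Set.Finite.of_finite_image (f := YoungDiagram.cells) ?_ ?_
  · refine lam.cells.powerset.finite_toSet.subset ?_
    rintro _ ⟨mu, hmu, rfl⟩
    exact Finset.mem_coe.2 (Finset.mem_powerset.2 hmu)
  · intro a _ b _ h
    exact YoungDiagram.ext h

/-- The finite set of all partitions `μ ⊂ λ`. -/
def subpartitions (lam : YoungDiagram) : Finset YoungDiagram := (finite_le lam).toFinset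

/-! ### Schur polynomials through raising operators -/

/-- The polynomial ring `A = ℤ[u₁, u₂, …]`. -/
abbrev A : Type := MvPolynomial ℕ+ ℤ

/-- The elements `u_r`, `r ∈ ℤ`, with `u₀ = 1` and `u_r = 0` for `r < 0`. -/
def u : ℤ → A
  | Int.ofNat 0 => 1
  | Int.ofNat (r + 1) => MvPolynomial.X r.succPNat
  | Int.negSucc _ => 0

/-- The `ℤ`-linear map `ψ : ℤ[ℤ^ℓ] → A` with `ψ(x^β) = u_β = ∏ i, u_{β_i}`. -/
def psi (l : ℕ) (f : AddMonoidAlgebra ℤ (Fin l → ℤ)) : A :=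
  f.coeff.sum fun β c => c • ∏ i, u (β i)

/-- The product `∏_{i<j} (1 - R_{ij})` in the group algebra `ℤ[ℤ^ℓ]`, where `R_{ij}` is the
element `x_i x_j⁻¹`, so that `R_{ij} x^β = x^{R_{ij} β}`. -/
def raisingProduct (l : ℕ) : AddMonoidAlgebra ℤ (Fin l → ℤ) :=
  ∏ p ∈ (Finset.univ : Finset (Fin l × Fin l)).filter (fun p => p.1 < p.2),
    (1 - AddMonoidAlgebra.single (Pi.single p.1 1 - Pi.single p.2 1) 1)

/-- The Schur polynomial `U_α = ∏_{i<j} (1 - R_{ij}) u_α` of an integer vector `α`. -/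
def U (α : ℕ →₀ ℤ) : A :=
  psi (vecLength α)
    (raisingProduct (vecLength α) *
      AddMonoidAlgebra.single (fun i : Fin (vecLength α) => α i) 1)

/-! ### Symmetric functions

Symmetric functions in a set of variables `σ` are elements of the power series ring
`ℤ⟦x_i : i ∈ σ⟧`. The standard alphabet `x = (x₁, x₂, …)` is `σ = ℕ` (with `x_{i+1}` indexed by
`i`), and the alphabet `(x, y)` made of two such sequences is `σ = ℕ ⊕ ℕ`. -/

/-- The complete symmetric function `h_r`, the sum of all monomials of degree `r`
(so `h₀ = 1`, and `h_r = 0` for `r < 0`). -/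
def h (σ : Type) (r : ℤ) : MvPowerSeries σ ℤ := by
  classical exact fun m => if (m.degree : ℤ) = r then 1 else 0

/-- The elementary symmetric function `e_r`, the sum of all squarefree monomials of degree `r`
(so `e₀ = 1`, and `e_r = 0` for `r < 0`). -/
def e (σ : Type) (r : ℤ) : MvPowerSeries σ ℤ := by
  classical exact fun m => if (m.degree : ℤ) = r ∧ ∀ i, m i ≤ 1 then 1 else 0

/-- The ring homomorphism `φ` with `φ(u_r) = h_r` for all `r ≥ 1`. -/
def phi (σ : Type) : A →ₐ[ℤ] MvPowerSeries σ ℤ := MvPolynomial.aeval fun r : ℕ+ => h σ (r : ℕ)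

/-- The Schur function `s_α = φ(U_α)` of an integer vector `α`, in the variables `σ`. -/
def schur (σ : Type) (α : ℕ →₀ ℤ) : MvPowerSeries σ ℤ := phi σ (U α)

instance : Filter.TendstoCofinite (Sum.inl : ℕ → ℕ ⊕ ℕ) :=
  ⟨Sum.inl_injective.tendsto_cofinite⟩

instance : Filter.TendstoCofinite (Sum.inr : ℕ → ℕ ⊕ ℕ) :=
  ⟨Sum.inr_injective.tendsto_cofinite⟩

/-- For a power series `f` in one sequence of variables, the series `f(x)` in the variables
`(x, y)`. -/
def inX : MvPowerSeries ℕ ℤ →ₐ[ℤ] MvPowerSeries (ℕ ⊕ ℕ) ℤ :=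
  MvPowerSeries.rename (Sum.inl : ℕ → ℕ ⊕ ℕ)

/-- For a power series `f` in one sequence of variables, the series `f(y)` in the variables
`(x, y)`. -/
def inY : MvPowerSeries ℕ ℤ →ₐ[ℤ] MvPowerSeries (ℕ ⊕ ℕ) ℤ :=
  MvPowerSeries.rename (Sum.inr : ℕ → ℕ ⊕ ℕ)

/-! ### Tableaux, Kostka numbers and skew Schur functions -/

/-- The boxes of the skew diagram `λ/μ` (used when `μ ⊂ λ`). Box `(i, j)` lies in row `i` and
column `j`. -/
abbrev SkewCells (lam mu : YoungDiagram) : Type := {c : ℕ × ℕ // c ∈ lam ∧ c ∉ mu}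

instance (lam mu : YoungDiagram) : Finite (SkewCells lam mu) :=
  (lam.cells.finite_toSet.subset fun _ hc => hc.1).to_subtype

instance (lam mu : YoungDiagram) : Fintype (SkewCells lam mu) := Fintype.ofFinite _

/-- Semistandard fillings of `λ/μ`: weakly increasing along rows and strictly increasing down
columns. The entry `k` here stands for the positive integer `k + 1`, as for the variables. -/
def IsTableau {lam mu : YoungDiagram} (T : SkewCells lam mu → ℕ) : Prop :=
  (∀ b c : SkewCells lam mu, b.1.1 = c.1.1 → b.1.2 < c.1.2 → T b ≤ T c) ∧
    ∀ b c : SkewCells lam mu, b.1.2 = c.1.2 → b.1.1 < c.1.1 → T b < T c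

/-- The content of a filling: its `k`-th entry is the number of boxes filled with `k`. -/
def content {lam mu : YoungDiagram} (T : SkewCells lam mu → ℕ) : ℕ →₀ ℕ :=
  ∑ c, Finsupp.single (T c) 1

/-- The tableaux of shape `λ/μ` and content `α`. -/
def tableaux (lam mu : YoungDiagram) (α : ℕ →₀ ℕ) : Set (SkewCells lam mu → ℕ) :=
  {T | IsTableau T ∧ content T = α}

theorem finite_tableaux (lam mu : YoungDiagram) (α : ℕ →₀ ℕ) : (tableaux lam mu α).Finite := by
  refine (Set.Finite.pi' (fun _ : SkewCells lam mu => α.support.finite_toSet)).subset ?_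
  rintro T ⟨-, rfl⟩ c
  simp only [Finset.mem_coe, Finsupp.mem_support_iff, content, Finsupp.finsetSum_apply]
  refine (Finset.sum_pos' (fun _ _ => Nat.zero_le _) ⟨c, Finset.mem_univ c, ?_⟩).ne'
  simp

/-- The Kostka number `K_{λ/μ,α}`: the number of tableaux of shape `λ/μ` and content `α`. -/
def kostka (lam mu : YoungDiagram) (α : ℕ →₀ ℕ) : ℕ := (tableaux lam mu α).ncard

/-- The skew Schur function `s_{λ/μ}(x) = ∑_T x^{c(T)}`, summed over all tableaux `T` of shape
`λ/μ`: the coefficient of `x^α` is the number of `T` with `c(T) = α`. -/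
def skewSchur (lam mu : YoungDiagram) : MvPowerSeries ℕ ℤ := fun α => (kostka lam mu α : ℤ)

end SkewJT

end

noncomputable section

namespace SkewJT

open Finset Matrix

variable {R : Type*} [CommRing R]

/-! For a power series `f = ∑ f_r t^r`, the determinant `jt f l λ μ` is the minor of the Toeplitz
matrix `(f_{p-q})` with rows `λ+ρ` and columns `μ+ρ`. Toeplitz matrices multiply as their series do,
so Cauchy–Binet gives `jt (f g) λ μ = ∑_ν jt f λ ν * jt g ν μ` (`jt_mul`). For `ν ⊂ λ`, the
determinant of `1/(1-xt)` is `x^|λ/ν|` if `λ/ν` is a horizontal strip and `0` otherwise; for `1+xt`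
the same holds with vertical strips. Removing the boxes with the largest entry from a tableau obeys
the same recursion (`tabSum_succ`), so (1) and (2) hold in `n` variables by induction
(`tabSum_eq_jt`, `tabSum_transpose_eq_jt`). A single coefficient sees only finitely many variables,
which gives the infinite case.

Up to a monomial, `∏ (1 - R_ij)` is a Vandermonde determinant, so `s_α = det(h_{α_i+j-i})`, and for
a partition `s_λ` is a Jacobi–Trudi determinant with `μ = ∅`. Then (3) is `jt_mul` for `H(x,y) =
H(x) H(y)`.

For (4), the linear map `x^β ↦ ∏ h_{(λ+ρ)_i - β_i}` (`shiftMap`) sends the alternant `a_{μ+ρ}` to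
`s_{λ/μ}` and `x^β a_ρ` to `s_{λ-β}`. Applied to `a_{μ+ρ} = s_μ a_ρ` (`tabSum_mul_alternant`), with
`s_μ = ∑_T x^{c(T)}`, it gives the sum over tableaux with at most `ℓ(λ)` distinct letters.
Compositions reaching beyond `ℓ(λ)` contribute zero. -/

/-! ### Toeplitz coefficients and Cauchy–Binet. -/

/-- The coefficients of a power series, extended by zero to negative indices. -/
def cf (f : PowerSeries R) (r : ℤ) : R := if 0 ≤ r then PowerSeries.coeff r.toNat f else 0

theorem cf_of_neg (f : PowerSeries R) {r : ℤ} (hr : r < 0) : cf f r = 0 := by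
  simp [cf, not_le.2 hr]

theorem cf_natCast (f : PowerSeries R) (n : ℕ) : cf f n = PowerSeries.coeff n f := by
  simp [cf]

theorem cf_natCast_sub (f : PowerSeries R) {m n : ℕ} (hmn : m ≤ n) :
    cf f ((n : ℤ) - m) = PowerSeries.coeff (n - m) f := by
  rw [← Nat.cast_sub hmn, cf_natCast]

theorem cf_map {S : Type*} [CommRing S] (φ : R →+* S) (f : PowerSeries R) (r : ℤ) :
    cf (PowerSeries.map φ f) r = φ (cf f r) := by
  by_cases hr : 0 ≤ r <;> simp [cf, hr]

/-- This is the product of Toeplitz matrices cut to finite size: only `q ≤ k ≤ p` contributes, and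
`p < N` keeps that range inside the sum. -/
theorem cf_mul (f g : PowerSeries R) {N p q : ℕ} (hp : p < N) :
    cf (f * g) ((p : ℤ) - q) = ∑ k ∈ range N, cf f ((p : ℤ) - k) * cf g ((k : ℤ) - q) := by
  rcases lt_or_ge p q with hpq | hpq
  · rw [cf_of_neg _ (by omega), Finset.sum_eq_zero]
    intro k _
    rcases lt_or_ge p k with hk | hk
    · rw [cf_of_neg f (by omega), zero_mul]
    · rw [cf_of_neg g (by omega), mul_zero]
  · rw [cf_natCast_sub _ hpq, PowerSeries.coeff_mul]
    symm
    rw [← Finset.sum_subset (s₁ := Finset.Icc q p)]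
    · refine Finset.sum_nbij' (fun k => (p - k, k - q)) (fun a => a.2 + q) ?_ ?_ ?_ ?_ ?_
      · intro k hk
        simp only [Finset.mem_Icc, Finset.HasAntidiagonal.mem_antidiagonal] at *
        omega
      · intro k hk
        simp only [Finset.mem_Icc, Finset.HasAntidiagonal.mem_antidiagonal] at *
        omega
      · intro k hk
        simp only [Finset.mem_Icc] at *
        omega
      · rintro ⟨a, b⟩ hk
        simp only [Finset.HasAntidiagonal.mem_antidiagonal, Prod.mk.injEq] at *
        omega
      · intro k hk
        rw [Finset.mem_Icc] at hk
        rw [cf_natCast_sub _ hk.1, cf_natCast_sub _ hk.2]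
    · intro k hk
      simp only [Finset.mem_Icc, Finset.mem_range] at *
      omega
    · intro k _ hk
      simp only [Finset.mem_Icc, not_and_or, not_le] at hk
      rcases hk with hk | hk
      · rw [cf_of_neg g (by omega), mul_zero]
      · rw [cf_of_neg f (by omega), zero_mul]

/-- The Cauchy–Binet formula. -/
theorem det_mul_eq_sum_strictMono {l : ℕ} {K : Type*} [Fintype K] [LinearOrder K]
    (M : Matrix (Fin l) K R) (N : Matrix K (Fin l) R) :
    (M * N).det = ∑ s : {s : Fin l → K // StrictMono s},
      (M.submatrix id s.1).det * (N.submatrix s.1 id).det := by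
  classical
  have h1 : (M * N).det = ∑ f : Fin l → K, (M.submatrix id f).det * ∏ i, N (f i) i := by
    rw [Matrix.det_apply']
    simp only [Matrix.mul_apply, Finset.prod_univ_sum, Finset.mul_sum, Fintype.piFinset_univ]
    rw [Finset.sum_comm]
    refine Finset.sum_congr rfl fun f _ => ?_
    rw [Matrix.det_apply', Finset.sum_mul]
    refine Finset.sum_congr rfl fun σ _ => ?_
    simp [Finset.prod_mul_distrib, mul_assoc]
  have h2 : ∀ s : {s : Fin l → K // StrictMono s},
      (M.submatrix id s.1).det * (N.submatrix s.1 id).det =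
        ∑ σ : Equiv.Perm (Fin l), (M.submatrix id (s.1 ∘ σ)).det * ∏ i, N ((s.1 ∘ σ) i) i := by
    intro s
    rw [Matrix.det_apply' (N.submatrix s.1 id), Finset.mul_sum]
    refine Finset.sum_congr rfl fun σ _ => ?_
    have := Matrix.det_permute' σ (M.submatrix id s.1)
    rw [Matrix.submatrix_submatrix] at this
    rw [Function.id_comp] at this
    rw [this]
    simp only [Matrix.submatrix_apply, Function.comp, id]
    ring
  simp only [h1, h2]
  rw [← Finset.sum_product', Finset.univ_product_univ]
  symm
  -- A map `f` that is not injective repeats a column and contributes zero; an injective one is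
  -- uniquely an increasing map after a permutation.
  refine Finset.sum_bij_ne_zero (fun x _ _ => x.1.1 ∘ x.2) (fun _ _ _ => Finset.mem_univ _) ?_ ?_
    (fun _ _ _ => rfl)
  · rintro ⟨⟨s, hs⟩, σ⟩ - - ⟨⟨t, ht⟩, τ⟩ - - hst
    have hst' : s ∘ σ = t ∘ τ := hst
    have hr : Set.range s = Set.range t := by
      rw [← σ.surjective.range_comp s, ← τ.surjective.range_comp t, hst']
    have : s = t := (hs.range_inj ht).1 hr
    subst this
    have : σ = τ := Equiv.ext fun i => hs.injective (congrFun hst' i)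
    subst this
    rfl
  · intro f _ hf
    have hinj : Function.Injective f := by
      intro i j hij
      by_contra hne
      exact hf (by rw [Matrix.det_zero_of_column_eq hne (by intro k; simp [hij]), zero_mul])
    have hmono : StrictMono (f ∘ Tuple.sort f) :=
      (Tuple.monotone_sort f).strictMono_of_injective (hinj.comp (Tuple.sort f).injective)
    have hcomp : (f ∘ Tuple.sort f) ∘ ((Tuple.sort f)⁻¹ : Equiv.Perm (Fin l)) = f := by
      ext i
      simp
    exact ⟨(⟨f ∘ Tuple.sort f, hmono⟩, (Tuple.sort f)⁻¹), Finset.mem_univ _,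
      by rw [hcomp]; exact hf, hcomp⟩

/-- Pigeonhole: the indices `≤ k` outnumber those `< k`. -/
theorem exists_le_le_perm {l : ℕ} (σ : Equiv.Perm (Fin l)) (k : Fin l) : ∃ i ≤ k, k ≤ σ i := by
  by_contra! hk
  have : (Finset.Iic k).card ≤ (Finset.Iio k).card :=
    Finset.card_le_card_of_injOn σ (fun i hi => by simpa using hk i (by simpa using hi))
      σ.injective.injOn
  simp at this

/-- The block of rows `≥ k` and columns `≤ k` has only negative indices, hence is zero, and every
permutation meets it. -/
theorem det_cf_eq_zero (f : PowerSeries R) {l : ℕ} {p s : Fin l → ℕ} (hp : Antitone p)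
    (hs : Antitone s) (k : Fin l) (hk : p k < s k) :
    (Matrix.of fun i j => cf f ((p i : ℤ) - s j)).det = 0 := by
  rw [Matrix.det_apply']
  refine Finset.sum_eq_zero fun σ _ => ?_
  obtain ⟨i, hi, hσ⟩ := exists_le_le_perm σ k
  have h1 := hp hσ
  have h2 := hs hi
  rw [Finset.prod_eq_zero (Finset.mem_univ i), mul_zero]
  simp only [Matrix.of_apply]
  exact cf_of_neg f (by omega)

/-! ### Jacobi–Trudi determinants as Toeplitz minors. -/

/-- The Jacobi–Trudi determinant of the diagrams `λ` and `μ`. -/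
def jt (f : PowerSeries R) (l : ℕ) (lam mu : YoungDiagram) : R :=
  (Matrix.of fun i j : Fin l =>
    cf f ((lam.rowLen i : ℤ) - (mu.rowLen j : ℤ) + ((j : ℕ) : ℤ) - ((i : ℕ) : ℤ))).det

/-- The strictly decreasing sequence `λ_i + l - 1 - i`. -/
def shifted (l : ℕ) (lam : YoungDiagram) (i : Fin l) : ℕ := lam.rowLen i + (l - 1 - i)

theorem shifted_strictAnti (l : ℕ) (lam : YoungDiagram) : StrictAnti (shifted l lam) := by
  intro i j hij
  have := lam.rowLen_anti i j hij.le
  have : (i : ℕ) < j := hij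
  simp only [shifted]
  omega

theorem jt_eq_shifted (f : PowerSeries R) (l : ℕ) (lam mu : YoungDiagram) :
    jt f l lam mu =
      (Matrix.of fun i j => cf f ((shifted l lam i : ℤ) - shifted l mu j)).det := by
  unfold jt
  congr 2
  ext i j
  congr 1
  simp only [shifted]
  omega

theorem jt_map {S : Type*} [CommRing S] (φ : R →+* S) (f : PowerSeries R) (l : ℕ)
    (lam mu : YoungDiagram) : jt (PowerSeries.map φ f) l lam mu = φ (jt f l lam mu) := by
  simp only [jt, cf_map, RingHom.map_det]
  rfl

theorem rowLen_mono {lam mu : YoungDiagram} (hle : mu ≤ lam) (i : ℕ) :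
    mu.rowLen i ≤ lam.rowLen i := by
  by_contra! hlt
  have := hle (YoungDiagram.mem_iff_lt_rowLen.2 hlt)
  rw [YoungDiagram.mem_iff_lt_rowLen] at this
  omega

theorem colLen_mono {lam mu : YoungDiagram} (hle : mu ≤ lam) (j : ℕ) :
    mu.colLen j ≤ lam.colLen j := by
  simpa [YoungDiagram.rowLen_transpose] using rowLen_mono (YoungDiagram.transpose_mono hle) j

theorem rowLen_eq_zero {lam : YoungDiagram} {i : ℕ} (hi : lam.colLen 0 ≤ i) :
    lam.rowLen i = 0 := by
  by_contra hne
  have := YoungDiagram.mem_iff_lt_colLen.1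
    (YoungDiagram.mem_iff_lt_rowLen.2 (Nat.pos_of_ne_zero hne))
  omega

theorem le_of_rowLen_le {lam mu : YoungDiagram} {l : ℕ} (hl : mu.colLen 0 ≤ l)
    (hle : ∀ i < l, mu.rowLen i ≤ lam.rowLen i) : mu ≤ lam := by
  rintro ⟨i, j⟩ hc
  have hc' : (i, j) ∈ mu := hc
  have h1 : i < mu.colLen 0 :=
    YoungDiagram.mem_iff_lt_colLen.1 (mu.up_left_mem le_rfl (Nat.zero_le j) hc')
  rw [YoungDiagram.mem_iff_lt_rowLen] at hc'
  exact YoungDiagram.mem_iff_lt_rowLen.2 (hc'.trans_le (hle i (by omega)))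

/-- Since `μ` has at most `l` rows, a failure of containment shows up in one of the rows that the
determinant sees. -/
theorem jt_eq_zero (f : PowerSeries R) {l : ℕ} {lam mu : YoungDiagram} (hl : mu.colLen 0 ≤ l)
    (hle : ¬ mu ≤ lam) : jt f l lam mu = 0 := by
  have : ∃ i < l, lam.rowLen i < mu.rowLen i := by
    by_contra! hcon
    exact hle (le_of_rowLen_le hl hcon)
  obtain ⟨i, hi, hlt⟩ := this
  rw [jt_eq_shifted]
  refine det_cf_eq_zero f (shifted_strictAnti l lam).antitone (shifted_strictAnti l mu).antitone
    ⟨i, hi⟩ ?_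
  simp only [shifted]
  omega

theorem mem_subpartitions {lam mu : YoungDiagram} : mu ∈ subpartitions lam ↔ mu ≤ lam := by
  simp [subpartitions]

theorem colLen_le_of_le {lam mu : YoungDiagram} {l : ℕ} (hl : lam.colLen 0 ≤ l) (hle : mu ≤ lam) :
    mu.colLen 0 ≤ l := (colLen_mono hle 0).trans hl

theorem shifted_injOn {lam mu : YoungDiagram} {l : ℕ} (hlam : lam.colLen 0 ≤ l)
    (hmu : mu.colLen 0 ≤ l) (heq : shifted l lam = shifted l mu) : lam = mu := by
  have : ∀ i < l, lam.rowLen i = mu.rowLen i := by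
    intro i hi
    have := congrFun heq ⟨i, hi⟩
    simp only [shifted] at this
    omega
  exact le_antisymm (le_of_rowLen_le hlam fun i hi => (this i hi).le)
    (le_of_rowLen_le hmu fun i hi => (this i hi).ge)

theorem le_add_of_strictAnti {l : ℕ} {s : Fin l → ℕ} (hs : StrictAnti s) (d : ℕ) :
    ∀ i j : Fin l, (j : ℕ) = i + d → s j + d ≤ s i := by
  induction d with
  | zero =>
    intro i j hij
    rw [show j = i from Fin.ext hij]
    simp
  | succ d ih =>
    intro i j hij
    have h1 := ih i ⟨i + d, by omega⟩ rfl
    have h2 : s j < s ⟨i + d, by omega⟩ := hs (by rw [Fin.lt_def]; simp only; omega)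
    omega

/-- Subtracting the staircase leaves a weakly decreasing sequence. This turns the column sets of
Cauchy–Binet into partitions. -/
theorem exists_shifted_eq {l : ℕ} {s : Fin l → ℕ} (hs : StrictAnti s) :
    ∃ nu : YoungDiagram, nu.colLen 0 ≤ l ∧ shifted l nu = s := by
  have hs' : ∀ i j : Fin l, i ≤ j → s j + (j - i : ℕ) ≤ s i := fun i j hij =>
    le_add_of_strictAnti hs _ i j (by rw [Fin.le_def] at hij; omega)
  have hlow : ∀ i : Fin l, l - 1 - i ≤ s i := fun i => by
    have hi := i.isLt
    have := hs' i ⟨l - 1, by omega⟩ (by rw [Fin.le_def]; simp only; omega)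
    simp only at this
    omega
  let w : List ℕ := List.ofFn fun i : Fin l => s i - (l - 1 - i)
  have hw : w.SortedGE := by
    have : Antitone fun i : Fin l => s i - (l - 1 - i) := by
      intro i j hij
      have h1 := hs' i j hij
      have h2 := hlow i
      have h3 : (i : ℕ) ≤ j := hij
      simp only
      omega
    exact this.sortedGE_ofFn
  have hmem : ∀ c : ℕ × ℕ, c ∈ YoungDiagram.ofRowLens w hw ↔
      ∃ h : c.1 < l, c.2 < s ⟨c.1, h⟩ - (l - 1 - c.1) := by
    intro c
    rw [YoungDiagram.mem_ofRowLens]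
    simp [w]
  refine ⟨YoungDiagram.ofRowLens w hw, ?_, ?_⟩
  · by_contra! hlt
    obtain ⟨h1, -⟩ := (hmem (l, 0)).1 (YoungDiagram.mem_iff_lt_colLen.2 hlt)
    exact lt_irrefl _ h1
  · ext i
    have h1 : ∀ j, j < (YoungDiagram.ofRowLens w hw).rowLen i ↔ j < s i - (l - 1 - i) := by
      intro j
      rw [← YoungDiagram.mem_iff_lt_rowLen, hmem]
      simp
    have h2 : (YoungDiagram.ofRowLens w hw).rowLen i = s i - (l - 1 - i) :=
      le_antisymm (not_lt.1 fun hlt => lt_irrefl _ ((h1 _).1 hlt))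
        (not_lt.1 fun hlt => lt_irrefl _ ((h1 _).2 hlt))
    have := hlow i
    simp only [shifted, h2]
    omega

/-- Multiplicativity of the Jacobi–Trudi determinants. -/
theorem jt_mul (f g : PowerSeries R) {l : ℕ} {lam : YoungDiagram} (mu : YoungDiagram)
    (hl : lam.colLen 0 ≤ l) :
    jt (f * g) l lam mu = ∑ nu ∈ subpartitions lam, jt f l lam nu * jt g l nu mu := by
  classical
  -- One more than the largest possible value `λ_0 + l - 1` of the shifted sequence.
  set N := lam.rowLen 0 + l with hN
  have hp : ∀ i, shifted l lam i < N := by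
    intro i
    have := lam.rowLen_anti 0 i (Nat.zero_le _)
    simp only [shifted]
    omega
  -- The inner index carries the reversed order, so that strictly monotone selections are strictly
  -- decreasing sequences.
  let A : Matrix (Fin l) (Fin N)ᵒᵈ R :=
    Matrix.of fun i k => cf f ((shifted l lam i : ℤ) - (OrderDual.ofDual k : Fin N))
  let B : Matrix (Fin N)ᵒᵈ (Fin l) R :=
    Matrix.of fun k j => cf g (((OrderDual.ofDual k : Fin N) : ℤ) - shifted l mu j)
  have hAB : jt (f * g) l lam mu = (A * B).det := by
    rw [jt_eq_shifted]
    congr 1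
    ext i j
    rw [Matrix.mul_apply, Matrix.of_apply, cf_mul f g (hp i), ← Fin.sum_univ_eq_sum_range
      (fun k => cf f ((shifted l lam i : ℤ) - k) * cf g ((k : ℤ) - shifted l mu j))]
    rfl
  rw [hAB, det_mul_eq_sum_strictMono]
  symm
  refine Finset.sum_bij_ne_zero
    (fun nu hnu _ => ⟨fun i => OrderDual.toDual ⟨shifted l nu i, ?_⟩, ?_⟩) ?_ ?_ ?_ ?_
  · have := rowLen_mono (mem_subpartitions.1 hnu) i
    have := hp i
    simp only [shifted] at *
    omega
  · intro i j hij
    exact shifted_strictAnti l nu hij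
  · intros
    exact Finset.mem_univ _
  · intro nu hnu _ nu' hnu' _ heq
    rw [mem_subpartitions] at hnu hnu'
    refine shifted_injOn (colLen_le_of_le hl hnu) (colLen_le_of_le hl hnu') ?_
    ext i
    have := congrFun (congrArg Subtype.val heq) i
    exact congrArg (fun k => ((OrderDual.ofDual k : Fin N) : ℕ)) this
  · rintro ⟨s, hs⟩ - hne
    have hs' : StrictAnti fun i => ((OrderDual.ofDual (s i) : Fin N) : ℕ) := fun i j hij => hs hij
    obtain ⟨nu, hnu, hnus⟩ := exists_shifted_eq hs'
    have hA : (A.submatrix id s).det = jt f l lam nu := by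
      rw [jt_eq_shifted, hnus]
      rfl
    have hB : (B.submatrix s id).det = jt g l nu mu := by
      rw [jt_eq_shifted, hnus]
      rfl
    simp only [hA, hB] at hne
    have hle : nu ≤ lam := by
      by_contra hcon
      exact hne (by rw [jt_eq_zero f hnu hcon, zero_mul])
    refine ⟨nu, mem_subpartitions.2 hle, hne, ?_⟩
    ext i
    exact congrFun hnus i
  · intro nu hnu hne
    rw [jt_eq_shifted, jt_eq_shifted]
    rfl

/-! ### One variable: horizontal and vertical strips. -/

/-- The geometric series `∑ x^k t^k`. -/
def geom (x : R) : PowerSeries R := PowerSeries.mk fun k => x ^ k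

theorem geom_mul (x : R) : geom x * (1 - PowerSeries.C x * PowerSeries.X) = 1 := by
  ext n
  cases n with
  | zero => simp [geom]
  | succ n =>
    rw [mul_sub, mul_one, map_sub, ← mul_assoc, PowerSeries.coeff_succ_mul_X,
      PowerSeries.coeff_mul_C]
    simp [geom, PowerSeries.coeff_one, pow_succ]

theorem card_skewCells {lam nu : YoungDiagram} {l : ℕ} (hl : lam.colLen 0 ≤ l) :
    Fintype.card (SkewCells lam nu) = ∑ i ∈ range l, (lam.rowLen i - nu.rowLen i) := by
  classical
  have h1 : Fintype.card (SkewCells lam nu) = (lam.cells \ nu.cells).card := by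
    rw [Fintype.card_of_subtype]
    intro c
    simp
  rw [h1, Finset.card_eq_sum_card_fiberwise (f := Prod.fst) (t := range l)]
  · refine Finset.sum_congr rfl fun i _ => ?_
    rw [← Nat.card_Ico]
    refine Finset.card_bij (fun c _ => c.2) ?_ ?_ ?_
    · rintro ⟨a, b⟩ hc
      simp only [mem_filter, mem_sdiff, YoungDiagram.mem_cells, YoungDiagram.mem_iff_lt_rowLen,
        Finset.mem_Ico] at *
      obtain ⟨hc, rfl⟩ := hc
      omega
    · rintro ⟨a, b⟩ hc ⟨a', b'⟩ hc' heq
      simp only [mem_filter] at *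
      rw [hc.2, hc'.2, heq]
    · intro b hb
      refine ⟨(i, b), ?_, rfl⟩
      simp only [mem_filter, mem_sdiff, YoungDiagram.mem_cells, YoungDiagram.mem_iff_lt_rowLen,
        Finset.mem_Ico, and_true] at hb ⊢
      omega
  · rintro ⟨i, j⟩ hc
    simp only [coe_sdiff, Set.mem_sdiff, Finset.mem_coe, YoungDiagram.mem_cells] at hc
    have : i < lam.colLen 0 :=
      YoungDiagram.mem_iff_lt_colLen.1 (lam.up_left_mem le_rfl (Nat.zero_le j) hc.1)
    simp only [coe_range, Set.mem_Iio]
    omega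

theorem prod_pow_shifted (x : R) {lam nu : YoungDiagram} {l : ℕ} (hl : lam.colLen 0 ≤ l) :
    ∏ i : Fin l, x ^ (shifted l lam i - shifted l nu i) =
      x ^ Fintype.card (SkewCells lam nu) := by
  rw [card_skewCells hl, Finset.prod_pow_eq_pow_sum,
    ← Fin.sum_univ_eq_sum_range (fun i => lam.rowLen i - nu.rowLen i)]
  congr 1
  refine Finset.sum_congr rfl fun i _ => ?_
  simp only [shifted]
  omega

theorem cf_geom (x : R) (p s : ℕ) :
    cf (geom x) ((p : ℤ) - s) = if s ≤ p then x ^ (p - s) else 0 := by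
  split_ifs with hsp
  · rw [cf_natCast_sub _ hsp, geom, PowerSeries.coeff_mk]
  · exact cf_of_neg _ (by omega)

/-- For `j < i` the strip condition gives `λ_i ≤ λ_{j+1} ≤ ν_j`, so the index is negative and the
matrix is upper triangular. -/
theorem jt_geom_of_strip (x : R) {lam nu : YoungDiagram} {l : ℕ} (hl : lam.colLen 0 ≤ l)
    (hle : nu ≤ lam) (hstrip : ∀ i, lam.rowLen (i + 1) ≤ nu.rowLen i) :
    jt (geom x) l lam nu = x ^ Fintype.card (SkewCells lam nu) := by
  rw [jt_eq_shifted, Matrix.det_of_isUpperTriangular, ← prod_pow_shifted x hl]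
  · refine Finset.prod_congr rfl fun i _ => ?_
    have := rowLen_mono hle i
    rw [Matrix.of_apply, cf_geom, if_pos]
    simp only [shifted]
    omega
  · intro i j hji
    have hji' : (j : ℕ) < i := hji
    have h1 := hstrip j
    have h2 := lam.rowLen_anti (j + 1) i hji'
    rw [Matrix.of_apply]
    apply cf_of_neg
    simp only [shifted]
    omega

/-- At the first `i` with `ν_i < λ_{i+1}`, rows `i` and `i+1` are proportional: both vanish in
columns `j < i` by minimality, and from column `i` on both consist of genuine powers of `x`. -/
theorem jt_geom_of_not_strip (x : R) {lam nu : YoungDiagram} {l : ℕ} (hl : lam.colLen 0 ≤ l)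
    (hstrip : ¬ ∀ i, lam.rowLen (i + 1) ≤ nu.rowLen i) : jt (geom x) l lam nu = 0 := by
  classical
  push Not at hstrip
  set i := Nat.find hstrip with hi
  have hlt : nu.rowLen i < lam.rowLen (i + 1) := Nat.find_spec hstrip
  have hmin : ∀ j < i, lam.rowLen (j + 1) ≤ nu.rowLen j := fun j hj =>
    not_lt.1 (Nat.find_min hstrip hj)
  have hil : i + 1 < l := by
    by_contra hcon
    have := rowLen_eq_zero (lam := lam) (i := i + 1) (by omega)
    omega
  rw [jt_eq_shifted]
  set M := (Matrix.of fun a b =>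
    cf (geom x) ((shifted l lam a : ℤ) - shifted l nu b) : Matrix (Fin l) (Fin l) R) with hM
  let a : Fin l := ⟨i, by omega⟩
  let b : Fin l := ⟨i + 1, hil⟩
  have hab : a ≠ b := by simp [a, b]
  have hanti := lam.rowLen_anti i (i + 1) (by omega)
  have hrow : M a = x ^ (shifted l lam a - shifted l lam b) • M b := by
    ext j
    simp only [hM, Matrix.of_apply, cf_geom, Pi.smul_apply, smul_eq_mul]
    rcases lt_or_ge (j : ℕ) i with hj | hj
    · have h1 := hmin j hj
      have h2 := lam.rowLen_anti (j + 1) i hj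
      rw [if_neg (by simp only [shifted, a]; omega), if_neg (by simp only [shifted, b]; omega),
        mul_zero]
    · have h1 := nu.rowLen_anti i j hj
      rw [if_pos (by simp only [shifted, a]; omega), if_pos (by simp only [shifted, b]; omega),
        ← pow_add]
      congr 1
      simp only [shifted, a, b]
      omega
  have hMupd : M = M.updateRow a (x ^ (shifted l lam a - shifted l lam b) • M b) := by
    rw [← hrow, Matrix.updateRow_eq_self]
  rw [hMupd, Matrix.det_updateRow_smul, Matrix.det_zero_of_row_eq hab, mul_zero]
  rw [Matrix.updateRow_self, Matrix.updateRow_ne hab.symm]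

/-- The linear series `1 + x t`. -/
def lin (x : R) : PowerSeries R := 1 + PowerSeries.C x * PowerSeries.X

theorem coeff_lin (x : R) (n : ℕ) : PowerSeries.coeff n (lin x) = if n ≤ 1 then x ^ n else 0 := by
  match n with
  | 0 => simp [lin]
  | 1 => simp [lin, PowerSeries.coeff_one]
  | n + 2 => simp [lin, PowerSeries.coeff_one]

theorem cf_lin (x : R) (p s : ℕ) :
    cf (lin x) ((p : ℤ) - s) = if s ≤ p ∧ p ≤ s + 1 then x ^ (p - s) else 0 := by
  rcases lt_or_ge p s with hps | hps
  · rw [if_neg (by omega), cf_of_neg _ (by omega)]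
  · rw [cf_natCast_sub _ hps, coeff_lin]
    simp only [hps, true_and]
    congr 1
    simp only [eq_iff_iff]
    omega

/-- A nonzero Leibniz term has each `λ`-value equal to its `ν`-value or one more. An inversion would
need a larger gap between strictly decreasing sequences, so only the identity survives. -/
theorem jt_lin (x : R) {lam nu : YoungDiagram} {l : ℕ} :
    jt (lin x) l lam nu =
      ∏ i, cf (lin x) ((shifted l lam i : ℤ) - shifted l nu i) := by
  rw [jt_eq_shifted, Matrix.det_apply', Finset.sum_eq_single 1]
  · simp
  · intro σ _ hσ
    by_contra hne
    apply hσ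
    have hne' : ∀ i, shifted l nu i ≤ shifted l lam (σ i) ∧
        shifted l lam (σ i) ≤ shifted l nu i + 1 := by
      intro i
      by_contra hcon
      apply hne
      rw [Finset.prod_eq_zero (Finset.mem_univ i), mul_zero]
      rw [Matrix.of_apply, cf_lin, if_neg hcon]
    have hmono : Monotone σ := by
      intro i j hij
      by_contra! hlt
      have hij' : i < j := lt_of_le_of_ne hij fun heq => by simp [heq] at hlt
      have h1 := shifted_strictAnti l lam hlt
      have h2 := shifted_strictAnti l nu hij'
      have h3 := hne' i
      have h4 := hne' j
      omega
    have : StrictMono σ := hmono.strictMono_of_injective σ.injective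
    ext i
    rw [show (σ : Fin l → Fin l) = id from
      (this.range_inj strictMono_id).1 (by simp)]
    rfl
  · simp

theorem jt_lin_of_strip (x : R) {lam nu : YoungDiagram} {l : ℕ} (hl : lam.colLen 0 ≤ l)
    (hle : nu ≤ lam) (hstrip : ∀ i, lam.rowLen i ≤ nu.rowLen i + 1) :
    jt (lin x) l lam nu = x ^ Fintype.card (SkewCells lam nu) := by
  rw [jt_lin, ← prod_pow_shifted x hl]
  refine Finset.prod_congr rfl fun i _ => ?_
  have h1 := rowLen_mono hle i
  have h2 := hstrip i
  rw [cf_lin, if_pos]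
  simp only [shifted]
  omega

theorem jt_lin_of_not_strip (x : R) {lam nu : YoungDiagram} {l : ℕ} (hl : lam.colLen 0 ≤ l)
    (hstrip : ¬ ∀ i, lam.rowLen i ≤ nu.rowLen i + 1) : jt (lin x) l lam nu = 0 := by
  push Not at hstrip
  obtain ⟨i, hi⟩ := hstrip
  have hil : i < l := by
    by_contra hcon
    have := rowLen_eq_zero (lam := lam) (i := i) (by omega)
    omega
  rw [jt_lin, Finset.prod_eq_zero (Finset.mem_univ ⟨i, hil⟩)]
  rw [cf_lin, if_neg]
  simp only [shifted]
  omega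

/-- The constant series is `1 + 0·t`, so the diagonal formula for `lin` applies. -/
theorem jt_one_self (lam : YoungDiagram) (l : ℕ) : jt (1 : PowerSeries R) l lam lam = 1 := by
  rw [show (1 : PowerSeries R) = lin 0 by simp [lin], jt_lin]
  exact Finset.prod_eq_one fun i _ => by rw [cf_lin]; simp

theorem jt_one_of_ne {lam mu : YoungDiagram} {l : ℕ} (hl : lam.colLen 0 ≤ l) (hle : mu ≤ lam)
    (hne : lam ≠ mu) : jt (1 : PowerSeries R) l lam mu = 0 := by
  have : ∃ i < l, mu.rowLen i < lam.rowLen i := by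
    by_contra! hcon
    exact hne (le_antisymm (le_of_rowLen_le hl hcon) hle)
  obtain ⟨i, hi, hlt⟩ := this
  rw [show (1 : PowerSeries R) = lin 0 by simp [lin], jt_lin,
    Finset.prod_eq_zero (Finset.mem_univ ⟨i, hi⟩)]
  rw [cf_lin]
  have : shifted l mu ⟨i, hi⟩ < shifted l lam ⟨i, hi⟩ := by
    simp only [shifted]
    omega
  split_ifs
  · exact zero_pow (by omega)
  · rfl

/-! ### Tableaux and removal of the largest entry. -/

theorem IsTableau.mono {lam mu : YoungDiagram} {T : SkewCells lam mu → ℕ} (hT : IsTableau T)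
    {b c : SkewCells lam mu} (h1 : b.1.1 ≤ c.1.1) (h2 : b.1.2 ≤ c.1.2) : T b ≤ T c := by
  have hrow : ∀ b c : SkewCells lam mu, b.1.1 = c.1.1 → b.1.2 ≤ c.1.2 → T b ≤ T c := by
    intro b c h1 h2
    rcases h2.eq_or_lt with h2 | h2
    · rw [show b = c from Subtype.ext (Prod.ext h1 h2)]
    · exact hT.1 b c h1 h2
  have hcol : ∀ b c : SkewCells lam mu, b.1.2 = c.1.2 → b.1.1 ≤ c.1.1 → T b ≤ T c := by
    intro b c h1 h2
    rcases h2.eq_or_lt with h2 | h2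
    · rw [show b = c from Subtype.ext (Prod.ext h2 h1)]
    · exact (hT.2 b c h1 h2).le
  -- The corner in the row of `b` and the column of `c` lies in `λ/μ`, because it lies between `b`
  -- and `c`.
  let d : SkewCells lam mu := ⟨(b.1.1, c.1.2), lam.up_left_mem h1 le_rfl c.2.1,
    fun hd => b.2.2 (mu.up_left_mem le_rfl h2 hd)⟩
  exact (hrow b d rfl h2).trans (hcol d c rfl h1)

theorem finite_boundedTableaux (n : ℕ) (lam mu : YoungDiagram) :
    {T : SkewCells lam mu → ℕ | IsTableau T ∧ ∀ c, T c < n}.Finite :=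
  (Set.Finite.pi' fun _ : SkewCells lam mu => Set.finite_Iio n).subset fun _ hT => hT.2

/-- The tableaux of shape `λ/μ` with entries less than `n`. -/
def boundedTableaux (n : ℕ) (lam mu : YoungDiagram) : Finset (SkewCells lam mu → ℕ) :=
  (finite_boundedTableaux n lam mu).toFinset

theorem mem_boundedTableaux {n : ℕ} {lam mu : YoungDiagram} {T : SkewCells lam mu → ℕ} :
    T ∈ boundedTableaux n lam mu ↔ IsTableau T ∧ ∀ c, T c < n := by
  simp [boundedTableaux]

/-- The generating function of the tableaux of shape `λ/μ` with entries less than `n`. -/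
def tabSum (x : ℕ → R) (n : ℕ) (lam mu : YoungDiagram) : R :=
  ∑ T ∈ boundedTableaux n lam mu, ∏ c, x (T c)

theorem tabSum_self (x : ℕ → R) (n : ℕ) (lam : YoungDiagram) : tabSum x n lam lam = 1 := by
  have : IsEmpty (SkewCells lam lam) := ⟨fun c => c.2.2 c.2.1⟩
  have hmem : boundedTableaux n lam lam = Finset.univ := by
    ext T
    simp [mem_boundedTableaux, IsTableau, eq_iff_true_of_subsingleton]
  rw [tabSum, hmem]
  simp

theorem tabSum_zero_of_ne (x : ℕ → R) {lam mu : YoungDiagram} (hle : mu ≤ lam) (hne : lam ≠ mu) :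
    tabSum x 0 lam mu = 0 := by
  have : ∃ c, c ∈ lam ∧ c ∉ mu := by
    by_contra! hcon
    exact hne (le_antisymm (fun c hc => hcon c hc) hle)
  obtain ⟨c, hc⟩ := this
  refine Finset.sum_eq_zero fun T hT => ?_
  exact absurd ((mem_boundedTableaux.1 hT).2 ⟨c, hc⟩) (Nat.not_lt_zero _)

theorem existsUnique_lower {lam mu : YoungDiagram} (hle : mu ≤ lam) {T : SkewCells lam mu → ℕ}
    (hT : IsTableau T) (n : ℕ) :
    ∃! nu : YoungDiagram, nu ≤ lam ∧ mu ≤ nu ∧ ∀ c : SkewCells lam mu, c.1 ∈ nu ↔ T c < n := by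
  classical
  let nu : YoungDiagram :=
    -- The condition is vacuous on `μ`, so this is `μ` together with the boxes whose entry is below
    -- `n`.
    { cells := lam.cells.filter fun c => ∀ h : c ∈ lam ∧ c ∉ mu, T ⟨c, h⟩ < n
      isLowerSet := by
        intro c d hdc hc
        simp only [coe_filter, Set.mem_ofPred_eq, YoungDiagram.mem_cells] at hc ⊢
        refine ⟨lam.up_left_mem hdc.1 hdc.2 hc.1, fun h => ?_⟩
        have hcmu : c ∉ mu := fun hcm => h.2 (mu.up_left_mem hdc.1 hdc.2 hcm)
        exact (hT.mono (b := ⟨d, h⟩) (c := ⟨c, hc.1, hcmu⟩) hdc.1 hdc.2).trans_lt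
          (hc.2 ⟨hc.1, hcmu⟩) }
  have hnu : ∀ c, c ∈ nu ↔ c ∈ lam ∧ ∀ h : c ∈ lam ∧ c ∉ mu, T ⟨c, h⟩ < n := by
    intro c
    rw [← YoungDiagram.mem_cells]
    simp [nu]
  refine ⟨nu, ⟨?_, ?_, ?_⟩, ?_⟩
  · intro c hc
    exact ((hnu c).1 hc).1
  · intro c hc
    exact (hnu c).2 ⟨hle hc, fun h => absurd hc h.2⟩
  · intro c
    rw [hnu]
    exact ⟨fun h => h.2 c.2, fun h => ⟨c.2.1, fun _ => h⟩⟩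
  · rintro nu' ⟨h1, h2, h3⟩
    apply le_antisymm
    · intro c hc
      exact (hnu c).2 ⟨h1 hc, fun h => (h3 ⟨c, h⟩).1 hc⟩
    · intro c hc
      by_cases hcm : c ∈ mu
      · exact h2 hcm
      · have := (hnu c).1 hc
        exact (h3 ⟨c, this.1, hcm⟩).2 (this.2 ⟨this.1, hcm⟩)

/-- The condition that `λ/ν` has at most one box in each column, when `ν ⊂ λ`. -/
def IsStrip (lam nu : YoungDiagram) : Prop := ∀ i j, (i + 1, j) ∈ lam → (i, j) ∈ nu

/-- Boxes outside `ν` all contain `n`, and a column cannot contain `n` twice. -/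
theorem isStrip_of_lower {n : ℕ} {lam mu nu : YoungDiagram} {T : SkewCells lam mu → ℕ}
    (hT : IsTableau T) (hTn : ∀ c, T c < n + 1) (hmu : mu ≤ nu)
    (hlow : ∀ c : SkewCells lam mu, c.1 ∈ nu ↔ T c < n) : IsStrip lam nu := by
  intro i j hij
  by_contra hnot
  have h1 : (i, j) ∉ mu := fun h => hnot (hmu h)
  have h2 : (i + 1, j) ∉ mu := fun h => h1 (mu.up_left_mem (Nat.le_succ i) le_rfl h)
  have h0 : (i, j) ∈ lam := lam.up_left_mem (Nat.le_succ i) le_rfl hij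
  have h3 := hT.2 ⟨(i, j), h0, h1⟩ ⟨(i + 1, j), hij, h2⟩ rfl (Nat.lt_succ_self i)
  have h4 := hTn ⟨(i + 1, j), hij, h2⟩
  exact hnot ((hlow ⟨(i, j), h0, h1⟩).2 (by omega))

/-- The filling of `λ/μ` that extends a filling of `ν/μ` by the entry `n`. -/
def extendFilling (n : ℕ) (lam : YoungDiagram) {mu nu : YoungDiagram} (S : SkewCells nu mu → ℕ)
    (c : SkewCells lam mu) : ℕ :=
  open Classical in if h : c.1 ∈ nu then S ⟨c.1, h, c.2.2⟩ else n

/-- The restriction to `ν/μ` of a filling of `λ/μ`. -/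
def restrictFilling {lam mu nu : YoungDiagram} (hnu : nu ≤ lam) (T : SkewCells lam mu → ℕ)
    (c : SkewCells nu mu) : ℕ := T ⟨c.1, hnu c.2.1, c.2.2⟩

/-- The strip condition puts every box lying above a box of `λ` into `ν`, where entries are below
`n`; this gives strictness down columns. -/
theorem isTableau_extendFilling {n : ℕ} {lam mu nu : YoungDiagram} (hstrip : IsStrip lam nu)
    {S : SkewCells nu mu → ℕ} (hS : IsTableau S) (hSn : ∀ c, S c < n) :
    IsTableau (extendFilling n lam S) := by
  classical
  constructor
  · intro b c h1 h2
    unfold extendFilling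
    by_cases hc : c.1 ∈ nu
    · have hb : b.1 ∈ nu := nu.up_left_mem h1.le h2.le hc
      rw [dif_pos hc, dif_pos hb]
      exact hS.1 _ _ h1 h2
    · rw [dif_neg hc]
      split_ifs with hb
      · exact (hSn _).le
      · exact le_rfl
  · intro b c h1 h2
    unfold extendFilling
    have hb : b.1 ∈ nu := by
      have : (b.1.1 + 1, b.1.2) ∈ lam := lam.up_left_mem h2 h1.le c.2.1
      exact hstrip _ _ this
    rw [dif_pos hb]
    split_ifs with hc
    · exact hS.2 _ _ h1 h2
    · exact hSn _

theorem isTableau_restrictFilling {lam mu nu : YoungDiagram} (hnu : nu ≤ lam)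
    {T : SkewCells lam mu → ℕ} (hT : IsTableau T) : IsTableau (restrictFilling hnu T) :=
  ⟨fun _ _ h1 h2 => hT.1 _ _ h1 h2, fun _ _ h1 h2 => hT.2 _ _ h1 h2⟩

theorem extendFilling_restrictFilling {n : ℕ} {lam mu nu : YoungDiagram} (hnu : nu ≤ lam)
    {T : SkewCells lam mu → ℕ} (hTn : ∀ c, T c < n + 1)
    (hlow : ∀ c : SkewCells lam mu, c.1 ∈ nu ↔ T c < n) :
    extendFilling n lam (restrictFilling hnu T) = T := by
  funext c
  unfold extendFilling
  split_ifs with hc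
  · rfl
  · rw [hlow] at hc
    have := hTn c
    omega

theorem prod_restrictFilling (x : ℕ → R) {n : ℕ} {lam mu nu : YoungDiagram} (hnu : nu ≤ lam)
    (hmu : mu ≤ nu) {T : SkewCells lam mu → ℕ} (hTn : ∀ c, T c < n + 1)
    (hlow : ∀ c : SkewCells lam mu, c.1 ∈ nu ↔ T c < n) :
    ∏ c, x (T c) =
      x n ^ Fintype.card (SkewCells lam nu) * ∏ c, x (restrictFilling hnu T c) := by
  classical
  rw [← Finset.prod_filter_mul_prod_filter_not Finset.univ (fun c => c.1 ∈ nu), mul_comm]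
  congr 1
  · rw [← Finset.card_univ, ← Finset.prod_const]
    refine Finset.prod_bij (fun c hc => ⟨c.1, c.2.1, by simpa using hc⟩) ?_ ?_ ?_ ?_
    · simp
    · intro a _ b _ hab
      exact Subtype.ext (Subtype.mk.inj hab)
    · intro b _
      exact ⟨⟨b.1, b.2.1, fun h => b.2.2 (hmu h)⟩, by simpa using b.2.2, rfl⟩
    · intro c hc
      have h1 : ¬ T c < n := by
        rw [← hlow]
        simpa using hc
      have h2 := hTn c
      rw [show T c = n by omega]
  · refine Finset.prod_bij (fun c hc => ⟨c.1, by simpa using hc, c.2.2⟩) ?_ ?_ ?_ ?_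
    · simp
    · intro a _ b _ hab
      exact Subtype.ext (Subtype.mk.inj hab)
    · intro b _
      exact ⟨⟨b.1, hnu b.2.1, b.2.2⟩, by simpa using b.2.1, rfl⟩
    · intro c hc
      rfl

-- Tableaux are sorted by the shape `ν` of their entries below `n`; for fixed `ν`, restriction and
-- extension by `n` are inverse bijections.
open Classical in
theorem tabSum_succ (x : ℕ → R) (n : ℕ) {lam mu : YoungDiagram} (hle : mu ≤ lam) :
    tabSum x (n + 1) lam mu = ∑ nu ∈ subpartitions lam,
      if mu ≤ nu ∧ IsStrip lam nu then
        x n ^ Fintype.card (SkewCells lam nu) * tabSum x n nu mu else 0 := by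
  have h1 : tabSum x (n + 1) lam mu = ∑ T ∈ boundedTableaux (n + 1) lam mu,
      ∑ nu ∈ subpartitions lam,
        if mu ≤ nu ∧ ∀ c : SkewCells lam mu, c.1 ∈ nu ↔ T c < n then ∏ c, x (T c) else 0 := by
    refine Finset.sum_congr rfl fun T hT => ?_
    obtain ⟨nu, ⟨h1, h2⟩, h3⟩ := existsUnique_lower hle (mem_boundedTableaux.1 hT).1 n
    rw [Finset.sum_eq_single nu, if_pos h2]
    · intro nu' hnu' hne
      rw [if_neg]
      exact fun h => hne (h3 nu' ⟨mem_subpartitions.1 hnu', h⟩)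
    · exact fun h => absurd (mem_subpartitions.2 h1) h
  rw [h1, Finset.sum_comm]
  refine Finset.sum_congr rfl fun nu hnu => ?_
  rw [mem_subpartitions] at hnu
  rw [← Finset.sum_filter]
  split_ifs with hcond
  · obtain ⟨hmu, hstrip⟩ := hcond
    rw [tabSum, Finset.mul_sum]
    refine Finset.sum_bij' (fun T _ => restrictFilling hnu T) (fun S _ => extendFilling n lam S)
      ?_ ?_ ?_ ?_ ?_
    · intro T hT
      rw [mem_filter, mem_boundedTableaux] at hT
      rw [mem_boundedTableaux]
      exact ⟨isTableau_restrictFilling hnu hT.1.1, fun c => (hT.2.2 _).1 c.2.1⟩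
    · intro S hS
      rw [mem_boundedTableaux] at hS
      rw [mem_filter, mem_boundedTableaux]
      refine ⟨⟨isTableau_extendFilling hstrip hS.1 hS.2, fun c => ?_⟩, hmu, fun c => ?_⟩
      · unfold extendFilling
        split_ifs
        · exact (hS.2 _).trans (Nat.lt_succ_self n)
        · exact Nat.lt_succ_self n
      · unfold extendFilling
        split_ifs with hc
        · simp [hc, hS.2]
        · simp [hc]
    · intro T hT
      rw [mem_filter, mem_boundedTableaux] at hT
      exact extendFilling_restrictFilling hnu hT.1.2 hT.2.2
    · intro S _
      funext c
      simp [restrictFilling, extendFilling, c.2.1]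
    · intro T hT
      rw [mem_filter, mem_boundedTableaux] at hT
      exact prod_restrictFilling x hnu hmu hT.1.2 hT.2.2
  · refine Finset.sum_eq_zero fun T hT => ?_
    rw [mem_filter, mem_boundedTableaux] at hT
    exact absurd ⟨hT.2.1, isStrip_of_lower hT.1.1 hT.1.2 hT.2.1 hT.2.2⟩ hcond

theorem isStrip_iff {lam nu : YoungDiagram} :
    IsStrip lam nu ↔ ∀ i, lam.rowLen (i + 1) ≤ nu.rowLen i := by
  simp only [IsStrip, YoungDiagram.mem_iff_lt_rowLen]
  refine forall_congr' fun i => ⟨fun h => ?_, fun h j hj => hj.trans_le h⟩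
  by_contra! hlt
  exact lt_irrefl _ (h _ hlt)

theorem isStrip_transpose_iff {lam nu : YoungDiagram} :
    IsStrip lam.transpose nu.transpose ↔ ∀ i, lam.rowLen i ≤ nu.rowLen i + 1 := by
  simp only [IsStrip, YoungDiagram.mem_transpose, Prod.swap_prod_mk]
  simp only [YoungDiagram.mem_iff_lt_rowLen]
  rw [forall_comm]
  refine forall_congr' fun i => ⟨fun h => ?_, fun h j hj => by omega⟩
  by_contra! hlt
  exact lt_irrefl _ (h _ hlt)

theorem card_skewCells_transpose (lam nu : YoungDiagram) :
    Fintype.card (SkewCells lam.transpose nu.transpose) = Fintype.card (SkewCells lam nu) := by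
  refine Fintype.card_congr ((Equiv.prodComm ℕ ℕ).subtypeEquiv fun c => ?_)
  simp only [YoungDiagram.mem_transpose]
  rfl

/-! ### Jacobi–Trudi in finitely many variables. -/

/-- The Jacobi–Trudi formula in finitely many variables. -/
theorem tabSum_eq_jt (x : ℕ → R) {l : ℕ} (n : ℕ) {lam mu : YoungDiagram} (hl : lam.colLen 0 ≤ l)
    (hle : mu ≤ lam) : tabSum x n lam mu = jt (∏ i ∈ range n, geom (x i)) l lam mu := by
  classical
  induction n generalizing lam with
  | zero =>
    rw [Finset.prod_range_zero]
    by_cases heq : lam = mu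
    · subst heq
      rw [tabSum_self, jt_one_self]
    · rw [tabSum_zero_of_ne x hle heq, jt_one_of_ne hl hle heq]
  | succ n ih =>
    -- The factor of the last variable goes first, since it accounts for the outer strip `λ/ν`.
    rw [tabSum_succ x n hle, Finset.prod_range_succ, mul_comm, jt_mul _ _ _ hl]
    refine Finset.sum_congr rfl fun nu hnu => ?_
    rw [mem_subpartitions] at hnu
    have hlnu := colLen_le_of_le hl hnu
    by_cases hmu : mu ≤ nu
    · by_cases hstrip : IsStrip lam nu
      · rw [if_pos ⟨hmu, hstrip⟩, ih hlnu hmu, jt_geom_of_strip _ hl hnu (isStrip_iff.1 hstrip)]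
      · rw [if_neg fun h => hstrip h.2, jt_geom_of_not_strip _ hl (mt isStrip_iff.2 hstrip),
          zero_mul]
    · rw [if_neg fun h => hmu h.1, jt_eq_zero _ ((colLen_mono hle 0).trans hl) hmu, mul_zero]

/-- The dual Jacobi–Trudi formula in finitely many variables. -/
theorem tabSum_transpose_eq_jt (x : ℕ → R) {l : ℕ} (n : ℕ) {lam mu : YoungDiagram}
    (hl : lam.colLen 0 ≤ l) (hle : mu ≤ lam) :
    tabSum x n lam.transpose mu.transpose = jt (∏ i ∈ range n, lin (x i)) l lam mu := by
  classical
  induction n generalizing lam with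
  | zero =>
    rw [Finset.prod_range_zero]
    by_cases heq : lam = mu
    · subst heq
      rw [tabSum_self, jt_one_self]
    · rw [tabSum_zero_of_ne x (YoungDiagram.transpose_mono hle)
        (mt YoungDiagram.transpose_eq_iff.1 heq), jt_one_of_ne hl hle heq]
  | succ n ih =>
    rw [tabSum_succ x n (YoungDiagram.transpose_mono hle), Finset.prod_range_succ, mul_comm,
      jt_mul _ _ _ hl]
    symm
    -- The recursion runs over subdiagrams of `λ'` and Cauchy–Binet over those of `λ`; transposition
    -- matches them.
    refine Finset.sum_bij' (fun nu _ => nu.transpose) (fun nu _ => nu.transpose) ?_ ?_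
      (fun nu _ => nu.transpose_transpose) (fun nu _ => nu.transpose_transpose) ?_
    · intro nu hnu
      rw [mem_subpartitions] at *
      exact YoungDiagram.transpose_mono hnu
    · intro nu hnu
      rw [mem_subpartitions] at *
      exact YoungDiagram.transpose_le_iff.1 (by rwa [YoungDiagram.transpose_transpose])
    intro nu hnu
    rw [mem_subpartitions] at hnu
    have hlnu := colLen_le_of_le hl hnu
    by_cases hmu : mu ≤ nu
    · by_cases hstrip : IsStrip lam.transpose nu.transpose
      · rw [if_pos ⟨YoungDiagram.transpose_mono hmu, hstrip⟩, ih hlnu hmu,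
          jt_lin_of_strip _ hl hnu (isStrip_transpose_iff.1 hstrip), card_skewCells_transpose]
      · rw [if_neg fun h => hstrip h.2,
          jt_lin_of_not_strip _ hl (mt isStrip_transpose_iff.2 hstrip), zero_mul]
    · rw [if_neg fun h => hmu (YoungDiagram.transpose_le_iff.1 h.1),
        jt_eq_zero _ ((colLen_mono hle 0).trans hl) hmu, mul_zero]

/-! ### Generating series and passage to infinitely many variables. -/

/-- The generating series of the complete symmetric functions. -/
def hSeries (σ : Type) : PowerSeries (MvPowerSeries σ ℤ) := PowerSeries.mk fun r => h σ r

/-- The generating series of the elementary symmetric functions. -/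
def eSeries (σ : Type) : PowerSeries (MvPowerSeries σ ℤ) := PowerSeries.mk fun r => e σ r

open Classical in
theorem coeff_h (σ : Type) (r : ℤ) (m : σ →₀ ℕ) :
    MvPowerSeries.coeff m (h σ r) = if (m.degree : ℤ) = r then 1 else 0 := rfl

open Classical in
theorem coeff_e (σ : Type) (r : ℤ) (m : σ →₀ ℕ) :
    MvPowerSeries.coeff m (e σ r) = if (m.degree : ℤ) = r ∧ ∀ i, m i ≤ 1 then 1 else 0 := rfl

theorem h_of_neg (σ : Type) {r : ℤ} (hr : r < 0) : h σ r = 0 := by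
  ext m
  rw [coeff_h, if_neg (by omega), map_zero]

theorem e_of_neg (σ : Type) {r : ℤ} (hr : r < 0) : e σ r = 0 := by
  ext m
  rw [coeff_e, if_neg (by omega), map_zero]

theorem h_zero (σ : Type) : h σ 0 = 1 := by
  classical
  ext m
  rw [coeff_h, MvPowerSeries.coeff_one]
  simp [Finsupp.degree_eq_zero_iff]

theorem cf_hSeries (σ : Type) (r : ℤ) : cf (hSeries σ) r = h σ r := by
  rcases lt_or_ge r 0 with hr | hr
  · rw [cf_of_neg _ hr, h_of_neg σ hr]
  · lift r to ℕ using hr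
    rw [cf_natCast, hSeries, PowerSeries.coeff_mk]

theorem cf_eSeries (σ : Type) (r : ℤ) : cf (eSeries σ) r = e σ r := by
  rcases lt_or_ge r 0 with hr | hr
  · rw [cf_of_neg _ hr, e_of_neg σ hr]
  · lift r to ℕ using hr
    rw [cf_natCast, eSeries, PowerSeries.coeff_mk]

/-- The series obtained by setting the variables `x_i`, `i ≥ n`, to zero. -/
def killFun (n : ℕ) (f : MvPowerSeries ℕ ℤ) : MvPowerSeries ℕ ℤ :=
  fun m => open Classical in if ∀ i, n ≤ i → m i = 0 then MvPowerSeries.coeff m f else 0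

open Classical in
theorem coeff_killFun (n : ℕ) (f : MvPowerSeries ℕ ℤ) (m : ℕ →₀ ℕ) :
    MvPowerSeries.coeff m (killFun n f) =
      if ∀ i, n ≤ i → m i = 0 then MvPowerSeries.coeff m f else 0 := rfl

/-- The ring homomorphism that sets the variables `x_i`, `i ≥ n`, to zero. -/
def killVars (n : ℕ) : MvPowerSeries ℕ ℤ →+* MvPowerSeries ℕ ℤ where
  toFun := killFun n
  map_one' := by
    classical
    ext m
    rw [coeff_killFun, MvPowerSeries.coeff_one]
    by_cases hm : m = 0 <;> simp [hm]
  map_zero' := by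
    ext m
    rw [coeff_killFun]
    simp
  map_add' f g := by
    ext m
    rw [map_add, coeff_killFun, coeff_killFun, coeff_killFun]
    split_ifs <;> simp
  map_mul' f g := by
    classical
    ext m
    rw [coeff_killFun, MvPowerSeries.coeff_mul m (killFun n f)]
    simp only [coeff_killFun]
    split_ifs with hm
    · rw [MvPowerSeries.coeff_mul]
      refine Finset.sum_congr rfl fun p hp => ?_
      rw [HasAntidiagonal.mem_antidiagonal] at hp
      have hp' : ∀ i, n ≤ i → p.1 i = 0 ∧ p.2 i = 0 := fun i hi => by
        have := hm i hi
        rw [← hp, Finsupp.add_apply] at this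
        omega
      rw [if_pos fun i hi => (hp' i hi).1, if_pos fun i hi => (hp' i hi).2]
    · symm
      refine Finset.sum_eq_zero fun p hp => ?_
      rw [HasAntidiagonal.mem_antidiagonal] at hp
      by_cases h1 : ∀ i, n ≤ i → p.1 i = 0
      · have h2 : ¬ ∀ i, n ≤ i → p.2 i = 0 := fun h2 =>
          hm fun i hi => by rw [← hp, Finsupp.add_apply, h1 i hi, h2 i hi]
        rw [if_neg h2, mul_zero]
      · rw [if_neg h1, zero_mul]

open Classical in
theorem coeff_killVars (n : ℕ) (f : MvPowerSeries ℕ ℤ) (m : ℕ →₀ ℕ) :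
    MvPowerSeries.coeff m (killVars n f) =
      if ∀ i, n ≤ i → m i = 0 then MvPowerSeries.coeff m f else 0 := coeff_killFun n f m

theorem forall_le_iff {n : ℕ} {P : ℕ → Prop} :
    (∀ i, n ≤ i → P i) ↔ P n ∧ ∀ i, n + 1 ≤ i → P i := by
  refine ⟨fun hP => ⟨hP n le_rfl, fun i hi => hP i (by omega)⟩, fun hP i hi => ?_⟩
  rcases hi.eq_or_lt with rfl | hi
  · exact hP.1
  · exact hP.2 i hi

theorem coeff_X_mul_of_eq_zero {n : ℕ} {m : ℕ →₀ ℕ} (hm : m n = 0) (f : MvPowerSeries ℕ ℤ) :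
    MvPowerSeries.coeff m (MvPowerSeries.X n * f) = 0 := by
  classical
  rw [MvPowerSeries.X_def, MvPowerSeries.coeff_monomial_mul, if_neg]
  intro hle
  have := hle n
  simp [hm] at this

theorem coeff_X_mul_add (n : ℕ) (m : ℕ →₀ ℕ) (f : MvPowerSeries ℕ ℤ) :
    MvPowerSeries.coeff (Finsupp.single n 1 + m) (MvPowerSeries.X n * f) =
      MvPowerSeries.coeff m f := by
  rw [MvPowerSeries.X_def, MvPowerSeries.coeff_add_monomial_mul, one_mul]

theorem exists_eq_single_add {n : ℕ} {m : ℕ →₀ ℕ} (hm : m n ≠ 0) :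
    ∃ m', m = Finsupp.single n 1 + m' :=
  exists_add_of_le (Finsupp.single_le_iff.2 (Nat.one_le_iff_ne_zero.2 hm))

theorem single_add_apply_of_lt {n i : ℕ} (hi : n + 1 ≤ i) (m : ℕ →₀ ℕ) :
    (Finsupp.single n 1 + m : ℕ →₀ ℕ) i = m i := by
  rw [Finsupp.add_apply, Finsupp.single_eq_of_ne (by omega), zero_add]

/-- A monomial either avoids `x_n` or is `x_n` times a monomial that may contain `x_n` again. -/
theorem killVars_succ_h (n r : ℕ) :
    killVars (n + 1) (h ℕ (r + 1 : ℕ)) =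
      killVars n (h ℕ (r + 1 : ℕ)) + MvPowerSeries.X n * killVars (n + 1) (h ℕ r) := by
  classical
  ext m
  rw [map_add]
  by_cases hm : m n = 0
  · rw [coeff_X_mul_of_eq_zero hm, add_zero, coeff_killVars, coeff_killVars]
    congr 1
    rw [forall_le_iff (n := n)]
    simp [hm]
  · obtain ⟨m, rfl⟩ := exists_eq_single_add hm
    have hne : ¬ ∀ i, n ≤ i → (Finsupp.single n 1 + m : ℕ →₀ ℕ) i = 0 :=
      fun hcon => hm (hcon n le_rfl)
    rw [coeff_X_mul_add, coeff_killVars, coeff_killVars n, coeff_killVars,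
      if_neg hne, zero_add, coeff_h, coeff_h]
    have h1 : (∀ i, n + 1 ≤ i → (Finsupp.single n 1 + m : ℕ →₀ ℕ) i = 0) ↔ ∀ i, n + 1 ≤ i → m i = 0 :=
      forall₂_congr fun i hi => by rw [single_add_apply_of_lt hi]
    have h2 : (((Finsupp.single n 1 + m).degree : ℕ) : ℤ) = (r + 1 : ℕ) ↔ (m.degree : ℤ) = r := by
      rw [map_add, Finsupp.degree_single]
      omega
    simp only [h1, h2]

/-- As for `h`, but squarefreeness forces the cofactor of `x_n` to avoid `x_n`, hence `killVars n`
in the last term. -/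
theorem killVars_succ_e (n r : ℕ) :
    killVars (n + 1) (e ℕ (r + 1 : ℕ)) =
      killVars n (e ℕ (r + 1 : ℕ)) + MvPowerSeries.X n * killVars n (e ℕ r) := by
  classical
  ext m
  rw [map_add]
  by_cases hm : m n = 0
  · rw [coeff_X_mul_of_eq_zero hm, add_zero, coeff_killVars, coeff_killVars]
    congr 1
    rw [forall_le_iff (n := n)]
    simp [hm]
  · obtain ⟨m, rfl⟩ := exists_eq_single_add hm
    have hne : ¬ ∀ i, n ≤ i → (Finsupp.single n 1 + m : ℕ →₀ ℕ) i = 0 :=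
      fun hcon => hm (hcon n le_rfl)
    rw [coeff_X_mul_add, coeff_killVars, coeff_killVars n, coeff_killVars,
      if_neg hne, zero_add, coeff_e, coeff_e,
      ← ite_and, ← ite_and]
    congr 1
    rw [forall_le_iff (n := n), map_add, Finsupp.degree_single, eq_iff_iff]
    have h1 : (∀ i, n + 1 ≤ i → (Finsupp.single n 1 + m : ℕ →₀ ℕ) i = 0) ↔ ∀ i, n + 1 ≤ i → m i = 0 :=
      forall₂_congr fun i hi => by rw [single_add_apply_of_lt hi]
    have h2 : (∀ i, (Finsupp.single n 1 + m : ℕ →₀ ℕ) i ≤ 1) ↔ m n = 0 ∧ ∀ i, m i ≤ 1 := by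
      constructor
      · intro h3
        constructor
        · have := h3 n
          simp at this
          exact this
        · intro i
          have := h3 i
          rw [Finsupp.add_apply] at this
          omega
      · rintro ⟨h3, h4⟩ i
        rw [Finsupp.add_apply, Finsupp.single_apply]
        split_ifs with hi
        · rw [← hi, h3]
        · rw [zero_add]
          exact h4 i
    rw [h1, h2]
    have h3 : ((1 + m.degree : ℕ) : ℤ) = (r + 1 : ℕ) ↔ (m.degree : ℤ) = r := by omega
    rw [h3]
    tauto

theorem killVars_h_zero (n : ℕ) : killVars n (h ℕ 0) = 1 := by rw [h_zero, map_one]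

theorem e_zero (σ : Type) : e σ 0 = 1 := by
  classical
  ext m
  rw [coeff_e, MvPowerSeries.coeff_one]
  by_cases hm : m = 0
  · simp [hm]
  · rw [if_neg, if_neg hm]
    rintro ⟨h1, -⟩
    exact hm (by simpa [Finsupp.degree_eq_zero_iff] using h1)

theorem killVars_zero_apply_of_ne {f : MvPowerSeries ℕ ℤ}
    (hf : MvPowerSeries.coeff 0 f = 0) : killVars 0 f = 0 := by
  ext m
  rw [coeff_killVars, map_zero]
  split_ifs with hm
  · rw [show m = 0 from Finsupp.ext fun i => hm i (Nat.zero_le i), hf]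
  · rfl

theorem constantCoeff_hSeries (σ : Type) : PowerSeries.constantCoeff (hSeries σ) = 1 := by
  rw [← PowerSeries.coeff_zero_eq_constantCoeff_apply, hSeries, PowerSeries.coeff_mk,
    Nat.cast_zero, h_zero]

theorem constantCoeff_map_hSeries {σ : Type} {S : Type*} [CommRing S]
    (φ : MvPowerSeries σ ℤ →+* S) :
    PowerSeries.constantCoeff (PowerSeries.map φ (hSeries σ)) = 1 := by
  rw [← PowerSeries.coeff_zero_eq_constantCoeff_apply, PowerSeries.coeff_map, hSeries,
    PowerSeries.coeff_mk, Nat.cast_zero, h_zero, map_one]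

theorem map_killVars_hSeries (n : ℕ) :
    PowerSeries.map (killVars n) (hSeries ℕ) = ∏ i ∈ range n, geom (MvPowerSeries.X i) := by
  induction n with
  | zero =>
    ext1 r
    rw [PowerSeries.coeff_map, hSeries, PowerSeries.coeff_mk, Finset.prod_range_zero,
      PowerSeries.coeff_one]
    split_ifs with hr
    · rw [hr, Nat.cast_zero, killVars_h_zero]
    · refine killVars_zero_apply_of_ne ?_
      rw [coeff_h, if_neg]
      simpa using Ne.symm (Nat.cast_ne_zero (R := ℤ).2 hr)
  | succ n ih =>
    rw [Finset.prod_range_succ, ← ih]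
    -- The recurrence for `h` reads `H_{n+1} (1 - x_n t) = H_n`; multiplying by the geometric series
    -- inverts the factor.
    have key : PowerSeries.map (killVars (n + 1)) (hSeries ℕ) *
        (1 - PowerSeries.C (MvPowerSeries.X n) * PowerSeries.X) =
          PowerSeries.map (killVars n) (hSeries ℕ) := by
      ext1 r
      cases r with
      | zero =>
        simp [constantCoeff_hSeries, constantCoeff_map_hSeries]
      | succ r =>
        rw [mul_sub, mul_one, map_sub, ← mul_assoc, PowerSeries.coeff_succ_mul_X,
          PowerSeries.coeff_mul_C]
        simp only [PowerSeries.coeff_map, hSeries, PowerSeries.coeff_mk]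
        rw [killVars_succ_h]
        ring
    rw [← key, mul_assoc, mul_comm (1 - _), geom_mul, mul_one]

theorem constantCoeff_eSeries (σ : Type) : PowerSeries.constantCoeff (eSeries σ) = 1 := by
  rw [← PowerSeries.coeff_zero_eq_constantCoeff_apply, eSeries, PowerSeries.coeff_mk,
    Nat.cast_zero, e_zero]

theorem constantCoeff_map_eSeries {σ : Type} {S : Type*} [CommRing S]
    (φ : MvPowerSeries σ ℤ →+* S) :
    PowerSeries.constantCoeff (PowerSeries.map φ (eSeries σ)) = 1 := by
  rw [← PowerSeries.coeff_zero_eq_constantCoeff_apply, PowerSeries.coeff_map, eSeries,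
    PowerSeries.coeff_mk, Nat.cast_zero, e_zero, map_one]

theorem map_killVars_eSeries (n : ℕ) :
    PowerSeries.map (killVars n) (eSeries ℕ) = ∏ i ∈ range n, lin (MvPowerSeries.X i) := by
  induction n with
  | zero =>
    ext1 r
    rw [PowerSeries.coeff_map, eSeries, PowerSeries.coeff_mk, Finset.prod_range_zero,
      PowerSeries.coeff_one]
    split_ifs with hr
    · rw [hr, Nat.cast_zero, e_zero, map_one]
    · refine killVars_zero_apply_of_ne ?_
      rw [coeff_e, if_neg]
      simpa using Ne.symm (Nat.cast_ne_zero (R := ℤ).2 hr)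
  | succ n ih =>
    rw [Finset.prod_range_succ, ← ih]
    ext1 r
    cases r with
    | zero => simp [lin, constantCoeff_eSeries, constantCoeff_map_eSeries]
    | succ r =>
      rw [lin, mul_add, mul_one, map_add, ← mul_assoc, PowerSeries.coeff_succ_mul_X,
        PowerSeries.coeff_mul_C]
      simp only [PowerSeries.coeff_map, eSeries, PowerSeries.coeff_mk]
      rw [killVars_succ_e]
      ring

theorem prod_X_eq_monomial {lam mu : YoungDiagram} (T : SkewCells lam mu → ℕ) :
    ∏ c, (MvPowerSeries.X (T c) : MvPowerSeries ℕ ℤ) =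
      MvPowerSeries.monomial (content T) 1 := by
  simp only [MvPowerSeries.X_def, content]
  rw [MvPowerSeries.prod_monomial]
  simp

theorem kostka_eq_card (n : ℕ) (lam mu : YoungDiagram) {α : ℕ →₀ ℕ}
    (hα : ∀ i, n ≤ i → α i = 0) [DecidableEq (ℕ →₀ ℕ)] :
    kostka lam mu α = ((boundedTableaux n lam mu).filter fun T => content T = α).card := by
  rw [kostka, ← Set.ncard_coe_finset]
  congr 1
  ext T
  simp only [tableaux, Set.mem_ofPred_eq, coe_filter, mem_boundedTableaux]
  refine ⟨fun hT => ⟨⟨hT.1, fun c => ?_⟩, hT.2⟩, fun hT => ⟨hT.1.1, hT.2⟩⟩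
  by_contra! hc
  have := hα _ hc
  rw [← hT.2, content, Finsupp.finsetSum_apply, Finset.sum_eq_zero_iff] at this
  simpa using this c (Finset.mem_univ c)

theorem coeff_tabSum (n : ℕ) (lam mu : YoungDiagram) {α : ℕ →₀ ℕ}
    (hα : ∀ i, n ≤ i → α i = 0) :
    MvPowerSeries.coeff α (tabSum MvPowerSeries.X n lam mu) = (kostka lam mu α : ℤ) := by
  classical
  rw [kostka_eq_card n lam mu hα, tabSum, map_sum, Finset.card_filter]
  push_cast
  refine Finset.sum_congr rfl fun T _ => ?_
  rw [prod_X_eq_monomial, MvPowerSeries.coeff_monomial]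
  simp only [eq_comm]

theorem exists_bound (α : ℕ →₀ ℕ) : ∃ n, ∀ i, n ≤ i → α i = 0 := by
  refine ⟨α.support.sup id + 1, fun i hi => ?_⟩
  by_contra hne
  have : id i ≤ α.support.sup id := Finset.le_sup (Finsupp.mem_support_iff.2 hne)
  simp only [id] at this
  omega

/-- Setting the variables absent from `x^α` to zero is a ring homomorphism, so it passes through the
determinant and preserves this coefficient. -/
theorem coeff_jt_eq (f : PowerSeries (MvPowerSeries ℕ ℤ)) {n : ℕ} (l : ℕ) (lam mu : YoungDiagram)
    {α : ℕ →₀ ℕ} (hα : ∀ i, n ≤ i → α i = 0) :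
    MvPowerSeries.coeff α (jt (PowerSeries.map (killVars n) f) l lam mu) =
      MvPowerSeries.coeff α (jt f l lam mu) := by
  rw [jt_map, coeff_killVars, if_pos hα]

/-- The Jacobi–Trudi formula. -/
theorem skewSchur_eq_jt {l : ℕ} {lam mu : YoungDiagram} (hl : lam.colLen 0 ≤ l) (hle : mu ≤ lam) :
    skewSchur lam mu = jt (hSeries ℕ) l lam mu := by
  ext α
  obtain ⟨n, hn⟩ := exists_bound α
  rw [← coeff_jt_eq _ l lam mu hn, map_killVars_hSeries, ← tabSum_eq_jt _ n hl hle,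
    coeff_tabSum n lam mu hn]
  rfl

/-- The dual Jacobi–Trudi formula. -/
theorem skewSchur_transpose_eq_jt {l : ℕ} {lam mu : YoungDiagram} (hl : lam.colLen 0 ≤ l)
    (hle : mu ≤ lam) :
    skewSchur lam.transpose mu.transpose = jt (eSeries ℕ) l lam mu := by
  ext α
  obtain ⟨n, hn⟩ := exists_bound α
  rw [← coeff_jt_eq _ l lam mu hn, map_killVars_eSeries, ← tabSum_transpose_eq_jt _ n hl hle,
    coeff_tabSum n _ _ hn]
  rfl

/-! ### Raising operators and determinants. -/

/-- The determinant `det(h_{α_i + j - i})` of size `l`. -/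
def vecDet (σ : Type) (l : ℕ) (α : ℕ → ℤ) : MvPowerSeries σ ℤ :=
  (Matrix.of fun i j : Fin l => h σ (α i + ((j : ℕ) : ℤ) - ((i : ℕ) : ℤ))).det

theorem phi_u (σ : Type) (r : ℤ) : phi σ (u r) = h σ r := by
  match r with
  | Int.ofNat 0 => rw [u, map_one, Int.ofNat_eq_natCast, Nat.cast_zero, h_zero]
  | Int.ofNat (r + 1) =>
    rw [u, phi, MvPolynomial.aeval_X]
    rfl
  | Int.negSucc r => rw [u, map_zero, h_of_neg σ (Int.negSucc_lt_zero r)]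

/-- The linear map `ψ` as an additive homomorphism. -/
def psiHom (l : ℕ) : AddMonoidAlgebra ℤ (Fin l → ℤ) →+ A :=
  AddMonoidHom.mk' (psi l) fun f g => by
    rw [psi, AddMonoidAlgebra.coeff_add, Finsupp.sum_add_index']
    · rfl
    · simp
    · simp [add_mul]

theorem psi_single (l : ℕ) (β : Fin l → ℤ) :
    psi l (AddMonoidAlgebra.single β 1) = ∏ i, u (β i) := by
  rw [psi, AddMonoidAlgebra.coeff_single, Finsupp.sum_single_index] <;> simp

theorem prod_single {ι M : Type*} [AddCommMonoid M] (s : Finset ι) (f : ι → M) :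
    ∏ i ∈ s, (AddMonoidAlgebra.single (f i) 1 : AddMonoidAlgebra ℤ M) =
      AddMonoidAlgebra.single (∑ i ∈ s, f i) 1 := by
  classical
  induction s using Finset.induction_on with
  | empty => simp [AddMonoidAlgebra.one_def]
  | insert a s ha ih =>
    rw [Finset.prod_insert ha, Finset.sum_insert ha, ih, AddMonoidAlgebra.single_mul_single, one_mul]

theorem prod_single_pow {l : ℕ} (k : Fin l → ℕ) :
    ∏ i, (AddMonoidAlgebra.single (Pi.single i 1) 1 : AddMonoidAlgebra ℤ (Fin l → ℤ)) ^ k i =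
      AddMonoidAlgebra.single (fun i => (k i : ℤ)) 1 := by
  simp only [AddMonoidAlgebra.single_pow, one_pow]
  rw [prod_single]
  congr 1
  ext i
  simp [Finset.sum_apply, Pi.single_apply]

/-- The monomial is `∏_{i<j} x_j`, and `x_j (1 - x_i x_j⁻¹) = x_j - x_i`. -/
theorem single_mul_raisingProduct (l : ℕ) :
    AddMonoidAlgebra.single (fun i : Fin l => ((i : ℕ) : ℤ)) 1 * raisingProduct l =
      (Matrix.vandermonde fun i : Fin l =>
        (AddMonoidAlgebra.single (Pi.single i 1) 1 : AddMonoidAlgebra ℤ (Fin l → ℤ))).det := by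
  classical
  have h1 : (AddMonoidAlgebra.single (fun i : Fin l => ((i : ℕ) : ℤ)) 1 :
      AddMonoidAlgebra ℤ (Fin l → ℤ)) =
      ∏ p ∈ (Finset.univ : Finset (Fin l × Fin l)).filter (fun p => p.1 < p.2),
        AddMonoidAlgebra.single (Pi.single p.2 1) 1 := by
    rw [Finset.prod_filter, Fintype.prod_prod_type_right, ← prod_single_pow fun i : Fin l => (i : ℕ)]
    refine Finset.prod_congr rfl fun j _ => ?_
    rw [← Finset.prod_filter]
    simp only
    rw [Finset.prod_const]
    congr 1
    rw [← Fin.card_Iio j]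
    congr 1
    ext i
    simp
  rw [h1, raisingProduct, ← Finset.prod_mul_distrib, Matrix.det_vandermonde, Finset.prod_filter,
    Fintype.prod_prod_type]
  refine Finset.prod_congr rfl fun i _ => ?_
  rw [← Finset.prod_filter]
  refine Finset.prod_congr ?_ fun j _ => ?_
  · ext j
    simp
  · simp only
    rw [mul_sub, mul_one, AddMonoidAlgebra.single_mul_single, one_mul, add_sub_cancel]

theorem raisingProduct_mul_single (l : ℕ) (α : Fin l → ℤ) :
    raisingProduct l * AddMonoidAlgebra.single α 1 =
      ∑ w : Equiv.Perm (Fin l), (Equiv.Perm.sign w : ℤ) •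
        AddMonoidAlgebra.single (fun i => α i + ((w i : ℕ) : ℤ) - ((i : ℕ) : ℤ)) 1 := by
  have h1 : (AddMonoidAlgebra.single α 1 : AddMonoidAlgebra ℤ (Fin l → ℤ)) =
      AddMonoidAlgebra.single (fun i : Fin l => ((i : ℕ) : ℤ)) 1 *
        AddMonoidAlgebra.single (fun i => α i - ((i : ℕ) : ℤ)) 1 := by
    rw [AddMonoidAlgebra.single_mul_single, one_mul]
    congr 1
    ext i
    simp
  rw [h1, ← mul_assoc, mul_comm (raisingProduct l), single_mul_raisingProduct,
    ← Matrix.det_transpose, Matrix.det_apply, Finset.sum_mul]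
  refine Finset.sum_congr rfl fun w _ => ?_
  simp only [Matrix.transpose_apply, Matrix.vandermonde_apply]
  rw [prod_single_pow fun i => (w i : ℕ), Units.smul_def, smul_mul_assoc,
    AddMonoidAlgebra.single_mul_single, one_mul]
  congr 2
  ext i
  simp only [Pi.add_apply]
  ring

theorem schur_eq_vecDet_vecLength (σ : Type) (α : ℕ →₀ ℤ) :
    schur σ α = vecDet σ (vecLength α) α := by
  have h1 : ∀ f, psi (vecLength α) f = psiHom (vecLength α) f := fun _ => rfl
  rw [schur, U, raisingProduct_mul_single, h1, map_sum, map_sum, vecDet, ← Matrix.det_transpose,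
    Matrix.det_apply]
  refine Finset.sum_congr rfl fun w _ => ?_
  rw [map_zsmul, map_zsmul, ← h1, psi_single, map_prod, Units.smul_def]
  simp only [phi_u, Matrix.transpose_apply, Matrix.of_apply]

/-- The new last row is `(0, …, 0, 1)`. Trailing zeros are thus harmless, and vectors of different
lengths can share one determinant size. -/
theorem vecDet_succ (σ : Type) (l : ℕ) {α : ℕ → ℤ} (hα : α l = 0) :
    vecDet σ (l + 1) α = vecDet σ l α := by
  rw [vecDet, Matrix.det_succ_row _ (Fin.last l), Finset.sum_eq_single (Fin.last l)]
  · have : (-1 : MvPowerSeries σ ℤ) ^ (l + l) = 1 := Even.neg_one_pow ⟨l, rfl⟩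
    simp [hα, h_zero, this, vecDet, Matrix.submatrix]
  · intro j _ hj
    have : (j : ℕ) < l := Fin.val_lt_last hj
    rw [Matrix.of_apply, h_of_neg σ (by rw [Fin.val_last, hα]; omega)]
    simp
  · simp

theorem apply_eq_zero_of_vecLength_le {α : ℕ →₀ ℤ} {i : ℕ} (hi : vecLength α ≤ i) : α i = 0 := by
  by_contra hne
  have : i + 1 ≤ vecLength α :=
    Finset.le_sup (f := fun i => i + 1) (Finsupp.mem_support_iff.2 hne)
  omega

theorem schur_eq_vecDet (σ : Type) {α : ℕ →₀ ℤ} {l : ℕ} (hl : vecLength α ≤ l) :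
    schur σ α = vecDet σ l α := by
  induction l, hl using Nat.le_induction with
  | base => exact schur_eq_vecDet_vecLength σ α
  | succ l hl ih => rw [ih, vecDet_succ σ l (apply_eq_zero_of_vecLength_le hl)]

/-- The last nonzero entry of `α` is negative, so the last row of the determinant has only negative
indices. -/
theorem schur_eq_zero (σ : Type) {α : ℕ →₀ ℤ} {k : ℕ} (hk : α k < 0) (hα : ∀ i, k < i → α i ≤ 0) :
    schur σ α = 0 := by
  have hlen : k < vecLength α := by
    by_contra! hcon
    rw [apply_eq_zero_of_vecLength_le hcon] at hk
    exact lt_irrefl _ hk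
  obtain ⟨n, hn⟩ : ∃ n, vecLength α = n + 1 := ⟨vecLength α - 1, by omega⟩
  have hneg : α n < 0 := by
    have hne : α n ≠ 0 := by
      intro h0
      have : vecLength α ≤ n := by
        refine Finset.sup_le fun i hi => ?_
        have h1 : i + 1 ≤ vecLength α := Finset.le_sup (f := fun i => i + 1) hi
        have h2 : i ≠ n := by
          rintro rfl
          exact Finsupp.mem_support_iff.1 hi h0
        omega
      omega
    rcases (show k = n ∨ k < n by omega) with rfl | hkn
    · exact hk
    · exact lt_of_le_of_ne (hα n hkn) hne
  rw [schur_eq_vecDet_vecLength, hn, vecDet]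
  refine Matrix.det_eq_zero_of_row_eq_zero (Fin.last n) fun j => ?_
  rw [Matrix.of_apply, h_of_neg]
  have := j.isLt
  rw [Fin.val_last]
  omega

theorem partVec_apply (lam : YoungDiagram) (i : ℕ) : partVec lam i = lam.rowLen i := rfl

theorem vecLength_partVec_le (lam : YoungDiagram) : vecLength (partVec lam) ≤ lam.colLen 0 := by
  refine Finset.sup_le fun i hi => ?_
  by_contra! hcon
  rw [Finsupp.mem_support_iff, partVec_apply, rowLen_eq_zero (by omega)] at hi
  exact hi rfl

theorem rowLen_bot (i : ℕ) : (⊥ : YoungDiagram).rowLen i = 0 := by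
  by_contra hne
  exact YoungDiagram.notMem_bot _
    (YoungDiagram.mem_iff_lt_rowLen.2 (Nat.pos_of_ne_zero hne) : (i, 0) ∈ (⊥ : YoungDiagram))

theorem schur_partVec (σ : Type) {lam : YoungDiagram} {l : ℕ} (hl : lam.colLen 0 ≤ l) :
    schur σ (partVec lam) = jt (hSeries σ) l lam ⊥ := by
  rw [schur_eq_vecDet σ ((vecLength_partVec_le lam).trans hl), vecDet, jt]
  congr 2
  ext i j : 2
  rw [cf_hSeries, partVec_apply, rowLen_bot]
  simp

/-! ### Two sets of variables. -/

theorem mapDomain_inl_add_apply_inl (a b : ℕ →₀ ℕ) (i : ℕ) :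
    (a.mapDomain Sum.inl + b.mapDomain Sum.inr : ℕ ⊕ ℕ →₀ ℕ) (Sum.inl i) = a i := by
  rw [Finsupp.add_apply, Finsupp.mapDomain_apply Sum.inl_injective,
    Finsupp.mapDomain_of_notMem_range _ _ (by simp), add_zero]

theorem mapDomain_inl_add_apply_inr (a b : ℕ →₀ ℕ) (i : ℕ) :
    (a.mapDomain Sum.inl + b.mapDomain Sum.inr : ℕ ⊕ ℕ →₀ ℕ) (Sum.inr i) = b i := by
  rw [Finsupp.add_apply, Finsupp.mapDomain_apply Sum.inr_injective,
    Finsupp.mapDomain_of_notMem_range _ _ (by simp), zero_add]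

theorem exists_eq_mapDomain_add (m : ℕ ⊕ ℕ →₀ ℕ) :
    ∃ a b : ℕ →₀ ℕ, m = a.mapDomain Sum.inl + b.mapDomain Sum.inr := by
  refine ⟨m.comapDomain Sum.inl Sum.inl_injective.injOn,
    m.comapDomain Sum.inr Sum.inr_injective.injOn, ?_⟩
  ext (i | i)
  · rw [mapDomain_inl_add_apply_inl, Finsupp.comapDomain_apply]
  · rw [mapDomain_inl_add_apply_inr, Finsupp.comapDomain_apply]

/-- An exponent in `(x, y)` splits uniquely into its two parts, so the convolution has one surviving
term. -/
theorem coeff_inX_mul_inY (f g : MvPowerSeries ℕ ℤ) (a b : ℕ →₀ ℕ) :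
    MvPowerSeries.coeff (a.mapDomain Sum.inl + b.mapDomain Sum.inr) (inX f * inY g) =
      MvPowerSeries.coeff a f * MvPowerSeries.coeff b g := by
  classical
  rw [MvPowerSeries.coeff_mul,
    Finset.sum_eq_single (a.mapDomain Sum.inl, b.mapDomain Sum.inr)]
  · have h1 := MvPowerSeries.coeff_embDomain_rename (Function.Embedding.inl : ℕ ↪ ℕ ⊕ ℕ) f a
    have h2 := MvPowerSeries.coeff_embDomain_rename (Function.Embedding.inr : ℕ ↪ ℕ ⊕ ℕ) g b
    rw [Finsupp.embDomain_eq_mapDomain] at h1 h2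
    exact congrArg₂ (· * ·) h1 h2
  · rintro ⟨p, q⟩ hpq hne
    rw [HasAntidiagonal.mem_antidiagonal] at hpq
    by_cases hp : p ∈ Set.range (Finsupp.mapDomain (M := ℕ) (Sum.inl : ℕ → ℕ ⊕ ℕ))
    · by_cases hq : q ∈ Set.range (Finsupp.mapDomain (M := ℕ) (Sum.inr : ℕ → ℕ ⊕ ℕ))
      · obtain ⟨a', rfl⟩ := hp
        obtain ⟨b', rfl⟩ := hq
        refine absurd ?_ hne
        have ha : a' = a := Finsupp.ext fun i => by
          rw [← mapDomain_inl_add_apply_inl a' b', hpq, mapDomain_inl_add_apply_inl]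
        have hb : b' = b := Finsupp.ext fun i => by
          rw [← mapDomain_inl_add_apply_inr a' b', hpq, mapDomain_inl_add_apply_inr]
        rw [ha, hb]
      · rw [inY, MvPowerSeries.coeff_rename_eq_zero (f := Sum.inr) g hq, mul_zero]
    · rw [inX, MvPowerSeries.coeff_rename_eq_zero (f := Sum.inl) f hp, zero_mul]
  · intro hcon
    exact absurd (by rw [HasAntidiagonal.mem_antidiagonal]) hcon

theorem hSeries_sum :
    hSeries (ℕ ⊕ ℕ) = PowerSeries.map (inX : _ →+* _) (hSeries ℕ) *
      PowerSeries.map (inY : _ →+* _) (hSeries ℕ) := by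
  classical
  ext r m
  obtain ⟨a, b, rfl⟩ := exists_eq_mapDomain_add m
  rw [PowerSeries.coeff_mul, map_sum]
  simp only [PowerSeries.coeff_map, hSeries, PowerSeries.coeff_mk,
    RingHom.coe_coe, coeff_inX_mul_inY, coeff_h, Nat.cast_inj, map_add, Finsupp.degree_mapDomain]
  split_ifs with hr
  · rw [Finset.sum_eq_single (a.degree, b.degree)]
    · simp
    · rintro ⟨i, j⟩ _ hne
      by_cases hi : a.degree = i
      · by_cases hj : b.degree = j
        · exact absurd (by rw [hi, hj]) hne
        · simp only [if_neg hj, mul_zero]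
      · simp only [if_neg hi, zero_mul]
    · intro hcon
      exact absurd (HasAntidiagonal.mem_antidiagonal.2 hr) hcon
  · symm
    refine Finset.sum_eq_zero fun p hp => ?_
    rw [HasAntidiagonal.mem_antidiagonal] at hp
    by_cases hi : a.degree = p.1
    · rw [if_neg (c := b.degree = p.2) (by omega), mul_zero]
    · rw [if_neg hi, zero_mul]

/-- The Schur function of a partition in two sets of variables. -/
theorem schur_sum (lam : YoungDiagram) :
    schur (ℕ ⊕ ℕ) (partVec lam) =
      ∑ mu ∈ subpartitions lam, inX (skewSchur lam mu) * inY (schur ℕ (partVec mu)) := by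
  have hl : lam.colLen 0 ≤ lam.colLen 0 := le_rfl
  rw [schur_partVec _ hl, hSeries_sum, jt_mul _ _ _ hl]
  refine Finset.sum_congr rfl fun mu hmu => ?_
  rw [mem_subpartitions] at hmu
  rw [jt_map, jt_map, skewSchur_eq_jt hl hmu, schur_partVec _ (colLen_le_of_le hl hmu)]
  rfl

/-! ### Alternants and the Kostka expansion. -/

theorem coeff_prod_linear_eq_zero (x : ℕ → R) (S : Finset ℕ) {m : ℕ} (hm : S.card < m) :
    PowerSeries.coeff m (∏ i ∈ S, (1 - PowerSeries.C (x i) * PowerSeries.X)) = 0 := by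
  induction S using Finset.induction_on generalizing m with
  | empty =>
    rw [Finset.prod_empty, PowerSeries.coeff_one, if_neg]
    rw [Finset.card_empty] at hm
    omega
  | insert a S ha ih =>
    rw [Finset.card_insert_of_notMem ha] at hm
    obtain ⟨m, rfl⟩ : ∃ k, m = k + 1 := ⟨m - 1, by omega⟩
    rw [Finset.prod_insert ha, mul_comm, mul_sub, mul_one, map_sub, ← mul_assoc,
      PowerSeries.coeff_succ_mul_X, PowerSeries.coeff_mul_C, ih (by omega), ih (by omega)]
    simp

theorem prod_geom_mul_prod_erase (x : ℕ → R) {n k : ℕ} (hk : k < n) :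
    (∏ i ∈ range n, geom (x i)) *
      ∏ i ∈ (range n).erase k, (1 - PowerSeries.C (x i) * PowerSeries.X) = geom (x k) := by
  rw [← Finset.mul_prod_erase _ _ (Finset.mem_range.2 hk), mul_assoc, ← Finset.prod_mul_distrib,
    Finset.prod_eq_one fun i _ => geom_mul (x i), mul_one]

/-- This is the coefficient of `t^p` in `1/(1 - x_k t)`, written as the full product of geometric
series times a polynomial of degree below `n`. The sum is reversed because `shifted n ⊥ j = n - 1 -
j`. -/
theorem pow_eq_sum_cf (x : ℕ → R) {n k : ℕ} (hk : k < n) (p : ℕ) :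
    x k ^ p = ∑ j : Fin n, cf (∏ i ∈ range n, geom (x i)) ((p : ℤ) - shifted n ⊥ j) *
      PowerSeries.coeff (shifted n ⊥ j)
        (∏ i ∈ (range n).erase k, (1 - PowerSeries.C (x i) * PowerSeries.X)) := by
  have h1 : x k ^ p = cf (geom (x k)) ((p : ℤ) - (0 : ℕ)) := by
    rw [cf_geom, if_pos (Nat.zero_le p), Nat.sub_zero]
  rw [h1, ← prod_geom_mul_prod_erase x hk, cf_mul _ _ (show p < p + 1 + n by omega),
    ← Finset.sum_subset (s₁ := range n)]
  · rw [← Finset.sum_range_reflect, Finset.sum_range]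
    refine Finset.sum_congr rfl fun j _ => ?_
    simp only [shifted, rowLen_bot, zero_add]
    rw [Nat.cast_zero, sub_zero, cf_natCast]
  · intro m hm
    simp only [Finset.mem_range] at *
    omega
  · intro m _ hm
    rw [Finset.mem_range] at hm
    rw [Nat.cast_zero, sub_zero, cf_natCast _ m, coeff_prod_linear_eq_zero, mul_zero]
    rw [Finset.card_erase_of_mem (Finset.mem_range.2 hk), Finset.card_range]
    omega

/-- The alternant `det(x_k^{λ_i + n - 1 - i})`. -/
def alternant (x : ℕ → R) (n : ℕ) (lam : YoungDiagram) : R :=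
  (Matrix.of fun i k : Fin n => x k ^ shifted n lam i).det

/-- The Schur polynomial in `n` variables as a ratio of alternants. -/
theorem tabSum_mul_alternant (x : ℕ → R) {n : ℕ} {lam : YoungDiagram} (hn : lam.colLen 0 ≤ n) :
    tabSum x n lam ⊥ * alternant x n ⊥ = alternant x n lam := by
  -- The alternant matrix is a Toeplitz matrix times one independent of `ν`; the case `ν = ⊥`
  -- identifies the determinant of the latter, without division.
  have key : ∀ nu : YoungDiagram, nu.colLen 0 ≤ n → alternant x n nu =
      tabSum x n nu ⊥ * (Matrix.of fun j k : Fin n => PowerSeries.coeff (shifted n ⊥ j)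
        (∏ i ∈ (range n).erase k, (1 - PowerSeries.C (x i) * PowerSeries.X))).det := by
    intro nu hnu
    rw [tabSum_eq_jt x n hnu bot_le, jt_eq_shifted, ← Matrix.det_mul, alternant]
    congr 1
    ext i k
    rw [Matrix.of_apply, pow_eq_sum_cf x k.isLt, Matrix.mul_apply]
    rfl
  have hbot : (⊥ : YoungDiagram).colLen 0 ≤ n := colLen_le_of_le hn bot_le
  rw [key lam hn, key ⊥ hbot, tabSum_self, one_mul]

/-- The linear map `x^β ↦ ∏ h_{p_i - β_i}`. -/
def shiftMap (l : ℕ) (p : Fin l → ℕ) : MvPolynomial ℕ ℤ →ₗ[ℤ] MvPowerSeries ℕ ℤ :=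
  (MvPolynomial.basisMonomials ℕ ℤ).constr ℤ fun β => ∏ i : Fin l, h ℕ ((p i : ℤ) - β i)

theorem shiftMap_monomial {l : ℕ} (p : Fin l → ℕ) (β : ℕ →₀ ℕ) :
    shiftMap l p (MvPolynomial.monomial β 1) = ∏ i : Fin l, h ℕ ((p i : ℤ) - β i) := by
  have := (MvPolynomial.basisMonomials ℕ ℤ).constr_basis ℤ
    (fun β => ∏ i : Fin l, h ℕ ((p i : ℤ) - β i)) β
  rwa [MvPolynomial.coe_basisMonomials] at this

theorem sum_single_apply {l : ℕ} (q : Fin l → ℕ) (i : Fin l) :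
    (∑ k : Fin l, Finsupp.single (k : ℕ) (q k)) (i : ℕ) = q i := by
  rw [Finsupp.finsetSum_apply, Finset.sum_eq_single i]
  · simp
  · intro j _ hj
    exact Finsupp.single_eq_of_ne fun heq => hj (Fin.ext heq.symm)
  · simp

theorem shiftMap_monomial_mul_alternant {l : ℕ} (p : Fin l → ℕ) (β : ℕ →₀ ℕ)
    (mu : YoungDiagram) :
    shiftMap l p (MvPolynomial.monomial β 1 * alternant MvPolynomial.X l mu) =
      (Matrix.of fun i j : Fin l => h ℕ ((p i : ℤ) - β i - shifted l mu j)).det := by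
  rw [alternant, Matrix.det_apply, Finset.mul_sum, map_sum, ← Matrix.det_transpose,
    Matrix.det_apply]
  refine Finset.sum_congr rfl fun w _ => ?_
  have h1 : ∏ k : Fin l, (MvPolynomial.X (k : ℕ) : MvPolynomial ℕ ℤ) ^ shifted l mu (w k) =
      MvPolynomial.monomial (∑ k : Fin l, Finsupp.single (k : ℕ) (shifted l mu (w k))) 1 := by
    rw [MvPolynomial.monomial_sum_one]
    exact Finset.prod_congr rfl fun k _ => MvPolynomial.X_pow_eq_monomial
  simp only [Matrix.of_apply, Matrix.transpose_apply]
  rw [h1, Units.smul_def, Units.smul_def, mul_smul_comm, MvPolynomial.monomial_mul, one_mul,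
    map_zsmul, shiftMap_monomial]
  congr 1
  refine Finset.prod_congr rfl fun i _ => ?_
  rw [Finsupp.add_apply, sum_single_apply]
  congr 1
  push_cast
  ring

/-- Apply `shiftMap` with `p = λ+ρ` to `a_{μ+ρ} = ∑_T x^{c(T)} a_ρ`: the left side becomes the
Jacobi–Trudi determinant, each term on the right a Schur function. -/
theorem jt_eq_sum_boundedTableaux {l : ℕ} {lam mu : YoungDiagram} (hl : lam.colLen 0 ≤ l)
    (hle : mu ≤ lam) :
    jt (hSeries ℕ) l lam mu = ∑ T ∈ boundedTableaux l mu ⊥,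
      schur ℕ (partVec lam - compVec (content T)) := by
  have hmu := colLen_le_of_le hl hle
  have h1 : jt (hSeries ℕ) l lam mu =
      shiftMap l (shifted l lam) (alternant MvPolynomial.X l mu) := by
    rw [← one_mul (alternant _ _ _),
      show (1 : MvPolynomial ℕ ℤ) = MvPolynomial.monomial 0 1 from rfl,
      shiftMap_monomial_mul_alternant, jt_eq_shifted]
    simp only [cf_hSeries, Finsupp.coe_zero, Pi.zero_apply, Nat.cast_zero, sub_zero]
  rw [h1, ← tabSum_mul_alternant _ hmu, tabSum, Finset.sum_mul, map_sum]
  refine Finset.sum_congr rfl fun T hT => ?_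
  rw [mem_boundedTableaux] at hT
  have h2 : ∏ c, (MvPolynomial.X (T c) : MvPolynomial ℕ ℤ) =
      MvPolynomial.monomial (content T) 1 := by
    rw [content, MvPolynomial.monomial_sum_one]
    rfl
  have h3 : vecLength (partVec lam - compVec (content T)) ≤ l := by
    refine Finset.sup_le fun i hi => ?_
    by_contra! hcon
    refine Finsupp.mem_support_iff.1 hi ?_
    have h4 : content T i = 0 := by
      rw [content, Finsupp.finsetSum_apply]
      refine Finset.sum_eq_zero fun c _ => Finsupp.single_eq_of_ne ?_
      have := hT.2 c
      omega
    rw [Finsupp.sub_apply, partVec_apply, rowLen_eq_zero (by omega), compVec,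
      Finsupp.mapRange_apply, h4]
    simp
  rw [h2, shiftMap_monomial_mul_alternant, schur_eq_vecDet ℕ h3, vecDet]
  congr 2
  ext i j : 2
  congr 1
  rw [Finsupp.sub_apply, partVec_apply, compVec, Finsupp.mapRange_apply]
  simp only [shifted, rowLen_bot]
  omega

/-- Beyond `ℓ(λ)` the vector is `-α`. This makes the sum over compositions finite and confines it to
tableaux with bounded entries. -/
theorem schur_partVec_sub_eq_zero {lam : YoungDiagram} {α : ℕ →₀ ℕ} {k : ℕ}
    (hk : lam.colLen 0 ≤ k) (hα : α k ≠ 0) : schur ℕ (partVec lam - compVec α) = 0 := by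
  have happ : ∀ i, lam.colLen 0 ≤ i → (partVec lam - compVec α) i = -(α i : ℤ) := by
    intro i hi
    rw [Finsupp.sub_apply, partVec_apply, rowLen_eq_zero hi, compVec, Finsupp.mapRange_apply]
    simp
  refine schur_eq_zero ℕ (k := k) ?_ fun i hi => ?_
  · rw [happ k hk]
    omega
  · rw [happ i (by omega)]
    omega

open Classical in
theorem support_kostka_smul_subset (lam mu : YoungDiagram) :
    (Function.support fun α : ℕ →₀ ℕ =>
      (kostka mu ⊥ α : ℤ) • schur ℕ (partVec lam - compVec α)) ⊆
        ((boundedTableaux (lam.colLen 0) mu ⊥).image content : Finset (ℕ →₀ ℕ)) := by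
  intro α hα
  rw [Function.mem_support] at hα
  have h1 : ∀ i, lam.colLen 0 ≤ i → α i = 0 := by
    intro i hi
    by_contra hne
    exact hα (by rw [schur_partVec_sub_eq_zero hi hne, smul_zero])
  have h2 : kostka mu ⊥ α ≠ 0 := fun h0 => hα (by rw [h0, Nat.cast_zero, zero_smul])
  rw [kostka_eq_card _ mu ⊥ h1, Finset.card_ne_zero] at h2
  obtain ⟨T, hT⟩ := h2
  rw [mem_filter] at hT
  exact Finset.mem_coe.2 (Finset.mem_image.2 ⟨T, hT⟩)

/-- The expansion of a skew Schur function with Kostka numbers as coefficients. -/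
theorem skewSchur_eq_finsum {lam mu : YoungDiagram} (hle : mu ≤ lam) :
    skewSchur lam mu = ∑ᶠ α : ℕ →₀ ℕ,
      (kostka mu ⊥ α : ℤ) • schur ℕ (partVec lam - compVec α) := by
  classical
  rw [finsum_eq_sum_of_support_subset _ (support_kostka_smul_subset lam mu),
    skewSchur_eq_jt le_rfl hle, jt_eq_sum_boundedTableaux le_rfl hle,
    -- Tableaux are grouped by content; each group is counted by a Kostka number, as contents vanish
    -- from `ℓ(λ)` on.
    ← Finset.sum_fiberwise_of_maps_to (fun T hT => Finset.mem_image_of_mem content hT)]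
  refine Finset.sum_congr rfl fun α hα => ?_
  obtain ⟨T, hT, rfl⟩ := Finset.mem_image.1 hα
  have h1 : ∀ i, lam.colLen 0 ≤ i → content T i = 0 := by
    intro i hi
    rw [content, Finsupp.finsetSum_apply]
    refine Finset.sum_eq_zero fun c _ => Finsupp.single_eq_of_ne ?_
    have := (mem_boundedTableaux.1 hT).2 c
    omega
  rw [kostka_eq_card _ mu ⊥ h1, natCast_zsmul, ← Finset.sum_const]
  refine Finset.sum_congr rfl fun S hS => ?_
  rw [(mem_filter.1 hS).2]

/-- The expansion of the Jacobi–Trudi determinant over permutations. -/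
theorem jt_hSeries_eq_sum_perm (l : ℕ) (lam mu : YoungDiagram) :
    jt (hSeries ℕ) l lam mu = ∑ w : Equiv.Perm (Fin l), (Equiv.Perm.sign w : ℤ) •
      ∏ i : Fin l, h ℕ (((lam.rowLen i : ℤ) + ((l : ℤ) - 1 - (i : ℕ))) -
        ((mu.rowLen (w⁻¹ i) : ℤ) + ((l : ℤ) - 1 - ((w⁻¹ i : Fin _) : ℕ)))) := by
  rw [jt, Matrix.det_apply]
  refine Finset.sum_congr rfl fun w _ => ?_
  rw [Units.smul_def]
  congr 1
  -- With `i = w j`, the two staircase terms combine to `j - i`.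
  refine Fintype.prod_equiv w _ _ fun j => ?_
  rw [Matrix.of_apply, cf_hSeries, show w⁻¹ (w j) = j from w.symm_apply_apply j]
  congr 1
  ring

end SkewJT

end

theorem mainTheorem8 :
    -- `s_{λ/μ} = ∑_w (-1)^w h_{λ+ρ-w(μ+ρ)} = det(h_{λ_i-μ_j+j-i})`, with `ρ_i = ℓ-1-i`
    -- (counting from `0`) and `(wβ)_i = β_{w⁻¹(i)}`
    (∀ lam mu : YoungDiagram, mu ≤ lam →
      SkewJT.skewSchur lam mu =
          ∑ w : Equiv.Perm (Fin (SkewJT.partLength lam)),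
            (Equiv.Perm.sign w : ℤ) •
              ∏ i : Fin (SkewJT.partLength lam),
                SkewJT.h ℕ
                  (((lam.rowLen i : ℤ) + ((SkewJT.partLength lam : ℤ) - 1 - (i : ℕ))) -
                    ((mu.rowLen (w⁻¹ i) : ℤ) +
                      ((SkewJT.partLength lam : ℤ) - 1 - ((w⁻¹ i : Fin _) : ℕ)))) ∧
      SkewJT.skewSchur lam mu =
          (Matrix.of fun i j : Fin (SkewJT.partLength lam) =>
            SkewJT.h ℕ
              ((lam.rowLen i : ℤ) - (mu.rowLen j : ℤ) + ((j : ℕ) : ℤ) - ((i : ℕ) : ℤ))).det) ∧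
    -- `s_{λ'/μ'} = det(e_{λ_i-μ_j+j-i})`
    (∀ lam mu : YoungDiagram, mu ≤ lam →
      SkewJT.skewSchur lam.transpose mu.transpose =
          (Matrix.of fun i j : Fin (SkewJT.partLength lam) =>
            SkewJT.e ℕ
              ((lam.rowLen i : ℤ) - (mu.rowLen j : ℤ) + ((j : ℕ) : ℤ) - ((i : ℕ) : ℤ))).det) ∧
    -- `s_λ(x,y) = ∑_{μ ⊂ λ} s_{λ/μ}(x) s_μ(y)`
    (∀ lam : YoungDiagram,
      SkewJT.schur (ℕ ⊕ ℕ) (SkewJT.partVec lam) =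
          ∑ mu ∈ SkewJT.subpartitions lam,
            SkewJT.inX (SkewJT.skewSchur lam mu) *
              SkewJT.inY (SkewJT.schur ℕ (SkewJT.partVec mu))) ∧
    -- `s_{λ/μ} = ∑_{α ≥ 0} K_{μ,α} s_{λ-α}`, a sum with finitely many nonzero terms
    (∀ lam mu : YoungDiagram, mu ≤ lam →
      (Function.support fun α : ℕ →₀ ℕ =>
        (SkewJT.kostka mu ⊥ α : ℤ) •
          SkewJT.schur ℕ (SkewJT.partVec lam - SkewJT.compVec α)).Finite ∧
      SkewJT.skewSchur lam mu =
          ∑ᶠ α : ℕ →₀ ℕ,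
            (SkewJT.kostka mu ⊥ α : ℤ) •
              SkewJT.schur ℕ (SkewJT.partVec lam - SkewJT.compVec α)) := by
  refine ⟨fun lam mu hle => ?_, fun lam mu hle => ?_, SkewJT.schur_sum, fun lam mu hle => ?_⟩
  · have hjt := SkewJT.skewSchur_eq_jt (le_refl (SkewJT.partLength lam)) hle
    refine ⟨?_, ?_⟩
    · rw [hjt, SkewJT.jt_hSeries_eq_sum_perm]
    · rw [hjt, SkewJT.jt]
      simp only [SkewJT.cf_hSeries]
  · rw [SkewJT.skewSchur_transpose_eq_jt (le_refl (SkewJT.partLength lam)) hle, SkewJT.jt]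
    simp only [SkewJT.cf_eSeries]
  · exact ⟨(Finset.finite_toSet _).subset (SkewJT.support_kostka_smul_subset lam mu),
      SkewJT.skewSchur_eq_finsum hle⟩
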